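/- Let $d\ge 1$ and regard $\mathbb Z^d$ as the lattice graph, $x\sim y$ iff $x-y\in\{\pm e_1,\dots,\pm e_d\}$, where $e_i$ is the $i$-th standard unit vector. Write $|x|=(\sum_i (x^i)^2)^{1/2}$, $\|u\|_2^2=\sum_x|u(x)|^2$, $\|\nabla u\|_2^2=\frac12\sum_{x}\sum_{y\sim x}|u(y)-u(x)|^2$, and $H^1(\mathbb Z^d)=\{u:\mathbb Z^d\to\mathbb R:\ \|u\|_2+\|\nabla u\|_2<\infty\}$. **Schwarz symmetry.** A function $u:\mathbb Z^d\to[0,\infty)$ is admissible if $\{x:u(x)>t\}$ is finite for every $t>0$. Let $\vec E=\{e_i,\ \frac{e_i+e_j}2,\ \frac{e_i-e_j}2:\ 1\le i<j\le d\}$ (all $e_i$, $1\le i\le d$). For $e\in\vec E$, partition $\mathbb Z^d$ into the classes $V$ of the relation "$x-y$ is parallel to $e$"; the map $x\mapsto\langle e,x\rangle$ is a bijection from each class $V$ onto $\mathbb Z$ or $\mathbb Z+\frac12$. Let $a_n(u,V)=\sup\{\min_\Omega u:\ \Omega\subset V,\ |\Omega|=n\}$ be the $n$-th largest value of $u$ on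 $V$. The one-step rearrangement $R_eu$ is given, for $x\in V$ and $s=\langle e,x\rangle$, by $R_eu(x)=a_{2s}(u,V)$ if $s>0$ and $R_eu(x)=a_{1-2s}(u,V)$ if $s\le 0$. Given an ordering of $\vec E$, let $R^ku$ be obtained from $u$ by applying the first $k$ of the one-step rearrangements, taken cyclically in this order. An admissible $u$ is *Schwarz symmetric* if, for every ordering of $\vec E$ (in particular for the order $e_1,e_2,\frac{e_1+e_2}2,\frac{e_1-e_2}2$ when $d=2$), it equals its Schwarz rearrangement, i.e. $\lim_{k\to\infty}R^ku(x)$ exists and equals $u(x)$ for all $x\in\mathbb Z^d$. **Theorem.** Let $F:[0,\infty)\times\mathbb R\to[0,\infty)$ satisfy: - $(F_0)$ $F(|x|,t)\le F(|x|,|t|)$ for all $x\in\mathbb Z^d$, $t\in\mathbb R$; - $(F_1)$ $F(|x|,\cdot)$ is continuous on $[0,\infty)$ for all $x\in\mathbb Z^d$; - $(F_2)$ there are $K>0$, $l>0$ with $0\le F(|x|,t)\le K(t^2+t^{l+2})$ for all $x\in\mathbb Z^d$, $t\ge0$; - $(F_3)$ for every $\epsilon>0$ there are $X_0>0$, $t_0>0$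 with $F(|x|,t)\le\epsilon t^2$ for all $x\in\mathbb Z^d$ with $|x|>X_0$ and all $|t|<t_0$; - $(F_4)$ $F(0,0)=0$ and $-F$ is supermodular on $[0,\infty)\times[0,\infty)$, that is, $G=-F$ satisfies $G(s+s_0,t+t_0)+G(s,t)\ge G(s,t+t_0)+G(s+s_0,t)$ for all $s,t,s_0,t_0\ge0$; - $(F_5)$ $F(|x|,\theta t)\ge\theta^2F(|x|,t)$ for all $x\in\mathbb Z^d$, $\theta\ge1$, $t\ge 0$; - $(F_6)$ there are $\delta>0$, $t_1>0$, $X_1>0$, $0<\sigma<\frac2d$ with $F(|x|,t)>\delta t^{2+2\sigma}$ for all $x\in\mathbb Z^d$ with $|x|>X_1$ and all $0<t<t_1$. Let $c\in\mathbb R$, $S_c=\{u\in H^1(\mathbb Z^d):\ \sum_xu(x)^2=c^2\}$, $E(u)=\frac12\|\nabla u\|_2^2-\sum_{x\in\mathbb Z^d}F(|x|,u(x))$ and $I_c=\inf\{E(u):u\in S_c\}$. Then $\sum_xF(|x|,u(x))$ converges for every $u\in S_c$, and there is a Schwarz symmetric $u\in S_c$ with $E(u)=I_c$. -/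

import Mathlib

open Filter Topology

namespace LatticeSchwarz

/-- The vertex set of the lattice graph: two vertices `x`, `y` are neighbours iff
`x = y + e` for some `e ∈ {± e_i}`. -/
abbrev Lattice (d : ℕ) : Type := Fin d → ℤ

/-- The `i`-th standard unit vector, as a lattice point. -/
def unitVec {d : ℕ} (i : Fin d) : Lattice d := Pi.single i 1

/-- The Euclidean norm `|x|` of a lattice point. -/
noncomputable def euclNorm {d : ℕ} (x : Lattice d) : ℝ :=
  Real.sqrt (∑ i, (x i : ℝ) ^ 2)

/-- `∑_{y ∼ x} |u(y) - u(x)|²`; the neighbours of `x` are the `2d` distinct points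
`x + e_i`, `x - e_i`. -/
def localGradSq {d : ℕ} (u : Lattice d → ℝ) (x : Lattice d) : ℝ :=
  ∑ i, (|u (x + unitVec i) - u x| ^ 2 + |u (x - unitVec i) - u x| ^ 2)

/-- `‖∇u‖₂² = (1/2) ∑_x ∑_{y ∼ x} |u(y) - u(x)|²` (meant for `u` in `H¹`). -/
noncomputable def gradNormSq {d : ℕ} (u : Lattice d → ℝ) : ℝ :=
  (1 / 2) * ∑' x, localGradSq u x

/-- `u ∈ H¹ = W^{1,2}`: both `‖u‖₂` and `‖∇u‖₂` are finite. -/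
def MemH1 {d : ℕ} (u : Lattice d → ℝ) : Prop :=
  Summable (fun x => |u x| ^ 2) ∧ Summable (localGradSq u)

/-- `S_c = {u ∈ H¹ : ∑_x u(x)² = c²}`. -/
def sphere (d : ℕ) (c : ℝ) : Set (Lattice d → ℝ) :=
  {u | MemH1 u ∧ ∑' x, u x ^ 2 = c ^ 2}

/-- `E(u) = (1/2) ‖∇u‖₂² - ∑_x F(|x|, u(x))`. -/
noncomputable def energy {d : ℕ} (F : ℝ → ℝ → ℝ) (u : Lattice d → ℝ) : ℝ :=
  (1 / 2) * gradNormSq u - ∑' x, F (euclNorm x) (u x)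

/-- `G : [0,∞) × [0,∞) → ℝ` is supermodular (values outside the quadrant are irrelevant). -/
def Supermodular (G : ℝ → ℝ → ℝ) : Prop :=
  ∀ s t s₀ t₀ : ℝ, 0 ≤ s → 0 ≤ t → 0 ≤ s₀ → 0 ≤ t₀ →
    G s (t + t₀) + G (s + s₀) t ≤ G (s + s₀) (t + t₀) + G s t

/-- Admissible functions: nonnegative and vanishing at infinity. -/
def Admissible {d : ℕ} (u : Lattice d → ℝ) : Prop :=
  (∀ x, 0 ≤ u x) ∧ ∀ t : ℝ, 0 < t → {x | t < |u x|}.Finite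

/-- The `i`-th standard unit vector of `ℝ^d`. -/
noncomputable def realUnitVec {d : ℕ} (i : Fin d) : Fin d → ℝ := Pi.single i 1

/-- The directions `e_i` and `(e_i + e_j)/2`, `(e_i - e_j)/2` for `i < j`, as a list; for `d = 2`
it is `e₁, e₂, (e₁ + e₂)/2, (e₁ - e₂)/2`. -/
noncomputable def directions (d : ℕ) : List (Fin d → ℝ) :=
  (List.finRange d).map realUnitVec ++
    (List.finRange d).flatMap fun i =>
      ((List.finRange d).filter fun j => i < j).flatMap fun j =>
        [(1 / 2 : ℝ) • (realUnitVec i + realUnitVec j),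
         (1 / 2 : ℝ) • (realUnitVec i - realUnitVec j)]

/-- The class of `x` for the relation "`y - x` is parallel to `e`". -/
def line {d : ℕ} (e : Fin d → ℝ) (x : Lattice d) : Set (Lattice d) :=
  {y | ∃ s : ℝ, ∀ i, ((y i - x i : ℤ) : ℝ) = s * e i}

/-- The position `⟨e, x⟩`, an element of `ℤ` or `ℤ + 1/2` for the directions above. -/
noncomputable def position {d : ℕ} (e : Fin d → ℝ) (x : Lattice d) : ℝ :=
  ∑ i, e i * (x i : ℝ)

/-- The rank of a position: `2s` if `s > 0` and `1 - 2s` if `s ≤ 0`. It enumerates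
`0, 1, -1, 2, -2, …` in `ℤ`, and `1/2, -1/2, 3/2, -3/2, …` in `ℤ + 1/2`, by `1, 2, 3, …`. On these
sets the floor changes nothing. -/
noncomputable def rank (s : ℝ) : ℕ :=
  if 0 < s then ⌊2 * s⌋₊ else ⌊1 - 2 * s⌋₊

/-- The `n`-th largest value (with multiplicity, `n ≥ 1`) of `u` on `V`:
the supremum over `Ω ⊆ V` with `|Ω| = n` of `min_Ω u`. -/
noncomputable def nthLargest {d : ℕ} (u : Lattice d → ℝ) (V : Set (Lattice d)) (n : ℕ) : ℝ :=
  sSup {m : ℝ | ∃ Ω : Finset (Lattice d), (Ω : Set (Lattice d)) ⊆ V ∧ Ω.card = n ∧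
    IsLeast (u '' (Ω : Set (Lattice d))) m}

/-- The one-step rearrangement `R_e`: the one-dimensional Schwarz rearrangement on each line
parallel to `e`. -/
noncomputable def oneStep {d : ℕ} (e : Fin d → ℝ) (u : Lattice d → ℝ) : Lattice d → ℝ :=
  fun x => nthLargest u (line e x) (rank (position e x))

/-- `R^k`: the first `k` one-step rearrangements, going cyclically through the list `L` of
directions, starting with its head. -/
noncomputable def iterRearr {d : ℕ} (L : List (Fin d → ℝ)) (u : Lattice d → ℝ) :
    ℕ → Lattice d → ℝ
  | 0 => u
  | k + 1 => oneStep (L.getD (k % L.length) 0) (iterRearr L u k)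

/-- `v` is the Schwarz rearrangement of `u` along `L`: the limit `lim_k R^k u (x)` exists and equals
`v x` for every `x`. -/
def IsSchwarzRearrangement {d : ℕ} (L : List (Fin d → ℝ)) (u v : Lattice d → ℝ) : Prop :=
  ∀ x, Tendsto (fun k => iterRearr L u k x) atTop (𝓝 (v x))

/-- `u` is Schwarz symmetric: it is admissible and equals its own Schwarz rearrangement, in whichever
order the directions are taken (in particular in the order of `directions d`). -/
def IsSchwarzSymmetric {d : ℕ} (u : Lattice d → ℝ) : Prop :=
  Admissible u ∧ ∀ L : List (Fin d → ℝ), L.Perm (directions d) → IsSchwarzRearrangement L u u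

end LatticeSchwarz

/-!
Write `E(u) = d ‖u‖² - J(u)` with `J(u) = (1/2) ∑_x ∑_{y ∼ x} u(x) u(y) + ∑_x F(|x|, u(x))`
(`gradNormSq_eq`, `IsNonlinearity.energy_eq`); the sphere `S_c` fixes the first term, and `J` only
grows when `u` is replaced by `|u|`.

*Symmetry.* The directions are the multiples `ν / |ν|²` of the roots `ν = e_i, e_i ± e_j`. Along each
line parallel to `ν` the order by `rank` is the order by distance to a fixed point `p` close to the
origin (up to a constant, the square of that distance is `level`), and two points of consecutive
ranks are exchanged by one of the two lattice reflections `x ↦ x + (b - m x) ν`, `b = 0, 1`, where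
`m = 2 ⟨ν, ·⟩ / |ν|²`. Hence a function whose value never increases under a reflection that moves the
point away from `p` (`ReflectionSymmetric`) decreases in `rank` along all these lines, is fixed by
all one-step rearrangements, and is Schwarz symmetric
(`ReflectionSymmetric.isSchwarzSymmetric`). So the rearrangements themselves never have to be
compared with the energy: it is enough to treat polarizations, which exchange the values of `u` on
the orbits of a single reflection. A polarization preserves `∑ u²`, does not decrease the edge sum
(rearrangement inequality for an edge and its mirror image) nor the nonlinear term
(supermodularity of `-F`), and strictly increases `∑ weight x * u x ^ 2` unless it fixes `u`.

*Existence.* On the compact set of nonnegative functions supported in `{level ≤ n}` with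
`∑ u² ≤ c²`, the functional `J(u) + (∑ weight x * u x ^ 2) / (n + 1)` has a maximizer, and by the
strict monotonicity it is reflection symmetric (`exists_symmetric_almost_maximizer`). A subsequence
converges pointwise to some `u`, again reflection symmetric. Symmetric functions decay uniformly
(`ReflectionSymmetric.mul_sq_le`), so by the smallness of `F` near `t = 0` for large `|x|` the
nonlinear term passes to the limit; the gradient term is lower semicontinuous. This gives
`∑ u² ≤ c²` and `E(u) ≤ E(v)` for all `v ∈ S_c` (`IsNonlinearity.exists_symmetric_energy_le`).

Finally, flat tents show that `E` is negative somewhere on `S_c` when `c ≠ 0`, because `σ < 2 / d`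
(`IsNonlinearity.exists_energy_neg`). So `E(u) < 0`, `u ≠ 0`, and for `θ = |c| / ‖u‖ ≥ 1` the
function `θ u` lies on `S_c` with `E(θ u) ≤ θ² E(u) ≤ E(u)` (`IsNonlinearity.exists_minimizer`).
-/

namespace LatticeSchwarz

section

/-! ### Reflections of the lattice -/

/-- The `2d` vectors `± e_i` joining a lattice point to its neighbours. -/
def steps (d : ℕ) : Finset (Lattice d) :=
  Finset.univ.image unitVec ∪ Finset.univ.image fun i => -unitVec i

/-- A strictly decreasing sequence in `(0, 1)`; twice the point from which `level` measures
distances. -/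
noncomputable def offset {d : ℕ} (i : Fin d) : ℝ := 1 / ((i : ℝ) + 2)

/-- `level x = |x - p|² - |p|²` with `p = offset / 2`. The shift by `p` breaks the ties of `|x|²`, so
that along every line in one of the given directions the points are strictly ordered by `level`
exactly as they are by `rank`. -/
noncomputable def level {d : ℕ} (x : Lattice d) : ℝ :=
  ∑ i, ((x i : ℝ) ^ 2 - offset i * (x i : ℝ))

/-- The properties used of the lattice vectors `ν = e_i`, `e_i + e_j`, `e_i - e_j` (`i < j`), together
with the integral functional `m x = 2 ⟨ν, x⟩ / |ν|²`. The bounds on `∑ offset i * ν i` say that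
`offset / 2` lies strictly between the hyperplanes `m = 0` and `m = 1`. -/
structure IsRoot {d : ℕ} (ν : Lattice d) (m : Lattice d →+ ℤ) : Prop where
  pairing_self : m ν = 2
  inner_eq : ∀ x, (∑ i, ν i ^ 2) * m x = 2 * ∑ i, ν i * x i
  exists_one : ∃ i, ν i = 1
  offset_pos : 0 < ∑ i, offset i * (ν i : ℝ)
  offset_lt : ∑ i, offset i * (ν i : ℝ) < ∑ i, (ν i : ℝ) ^ 2
  map_steps : ∀ e ∈ steps d, e - m e • ν ∈ steps d
  eq_of_step : ∀ e ∈ steps d, |m e| ≤ 1 ∨ e = ν ∨ e = -ν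

/-- The reflection of the lattice in the hyperplane `m = b`, orthogonal to `ν`. -/
def reflect {d : ℕ} (ν : Lattice d) (m : Lattice d →+ ℤ) (b : ℤ) (x : Lattice d) : Lattice d :=
  x + (b - m x) • ν

variable {d : ℕ} {ν : Lattice d} {m : Lattice d →+ ℤ}

lemma mem_steps {e : Lattice d} : e ∈ steps d ↔ ∃ i, e = unitVec i ∨ e = -unitVec i := by
  simp only [steps, Finset.mem_union, Finset.mem_image, Finset.mem_univ, true_and, eq_comm (a := e)]
  exact exists_or.symm

lemma sum_steps (g : Lattice d → ℝ) :
    ∑ e ∈ steps d, g e = ∑ i, (g (unitVec i) + g (-unitVec i)) := by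
  have hinj : Function.Injective (unitVec : Fin d → Lattice d) := by
    intro i j h
    have := congrFun h i
    by_contra hij
    simp [unitVec, hij] at this
  rw [steps, Finset.sum_union, Finset.sum_image (fun i _ j _ h => hinj h),
    Finset.sum_image (fun i _ j _ h => hinj (neg_injective h)), Finset.sum_add_distrib]
  rw [Finset.disjoint_left]
  intro e he he'
  simp only [Finset.mem_image, Finset.mem_univ, true_and] at he he'
  obtain ⟨i, rfl⟩ := he
  obtain ⟨j, hj⟩ := he'
  have := congrFun hj i
  simp only [unitVec, Pi.single_apply, Pi.neg_apply] at this
  split_ifs at this; simp_all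

lemma card_steps (d : ℕ) : ((steps d).card : ℝ) = 2 * d := by
  have := sum_steps (d := d) fun _ => 1
  simp only [Finset.sum_const, nsmul_eq_mul, mul_one, Finset.card_univ, Fintype.card_fin] at this
  rw [this]; ring

namespace IsRoot

lemma map_reflect (h : IsRoot ν m) (b : ℤ) (x : Lattice d) :
    m (reflect ν m b x) = 2 * b - m x := by
  simp only [reflect, map_add, map_zsmul, h.pairing_self, smul_eq_mul]
  ring

lemma reflect_involutive (h : IsRoot ν m) (b : ℤ) : Function.Involutive (reflect ν m b) := by
  intro x
  rw [reflect, h.map_reflect, reflect, add_assoc, ← add_smul]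
  simp [show b - m x + (b - (2 * b - m x)) = 0 by ring]

/-- The reflection in `m = b` as a permutation of the lattice. -/
def perm (h : IsRoot ν m) (b : ℤ) : Equiv.Perm (Lattice d) :=
  (h.reflect_involutive b).toPerm

lemma inner_eq_real (h : IsRoot ν m) (x : Lattice d) :
    (∑ i, (ν i : ℝ) ^ 2) * (m x : ℝ) = 2 * ∑ i, (ν i : ℝ) * (x i : ℝ) := by
  exact_mod_cast h.inner_eq x

lemma sum_sq_reflect (h : IsRoot ν m) (b : ℤ) (x : Lattice d) :
    ∑ i, (reflect ν m b x i : ℝ) ^ 2 =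
      ∑ i, (x i : ℝ) ^ 2 + ((b - m x : ℤ) : ℝ) * b * ∑ i, (ν i : ℝ) ^ 2 := by
  have hx := h.inner_eq_real x
  have h1 : ∀ i, (reflect ν m b x i : ℝ) ^ 2 = (x i : ℝ) ^ 2
      + 2 * ((b - m x : ℤ) : ℝ) * ((ν i : ℝ) * x i)
      + ((b - m x : ℤ) : ℝ) ^ 2 * (ν i : ℝ) ^ 2 := by
    intro i
    simp only [reflect, Pi.add_apply, Pi.smul_apply, smul_eq_mul]
    push_cast
    ring
  simp only [h1, Finset.sum_add_distrib, ← Finset.mul_sum]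
  push_cast
  linear_combination (-((b : ℝ) - m x)) * hx

lemma level_reflect (h : IsRoot ν m) (b : ℤ) (x : Lattice d) :
    level (reflect ν m b x) = level x + ((b - m x : ℤ) : ℝ) *
      (b * (∑ i, (ν i : ℝ) ^ 2) - ∑ i, offset i * (ν i : ℝ)) := by
  have h1 : ∑ i, offset i * (reflect ν m b x i : ℝ) = ∑ i, offset i * (x i : ℝ)
      + ((b - m x : ℤ) : ℝ) * ∑ i, offset i * (ν i : ℝ) := by
    rw [Finset.mul_sum, ← Finset.sum_add_distrib]
    refine Finset.sum_congr rfl fun i _ => ?_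
    simp only [reflect, Pi.add_apply, Pi.smul_apply, smul_eq_mul]
    push_cast
    ring
  simp only [level, Finset.sum_sub_distrib, h1, h.sum_sq_reflect]
  ring

lemma level_le_reflect_zero (h : IsRoot ν m) (x : Lattice d) :
    level x ≤ level (reflect ν m 0 x) ↔ 0 ≤ m x := by
  rw [h.level_reflect, le_add_iff_nonneg_right]
  have := h.offset_pos
  have h2 : ((0 - m x : ℤ) : ℝ) * (((0 : ℤ) : ℝ) * (∑ i, (ν i : ℝ) ^ 2)
      - ∑ i, offset i * (ν i : ℝ)) = (m x : ℝ) * ∑ i, offset i * (ν i : ℝ) := by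
    push_cast; ring
  rw [h2, mul_nonneg_iff_of_pos_right this]
  exact_mod_cast Iff.rfl

lemma level_le_reflect_one (h : IsRoot ν m) (x : Lattice d) :
    level x ≤ level (reflect ν m 1 x) ↔ m x ≤ 1 := by
  rw [h.level_reflect, le_add_iff_nonneg_right]
  have := sub_pos.2 h.offset_lt
  rw [Int.cast_one, one_mul, mul_nonneg_iff_of_pos_right this]
  norm_cast
  omega

/-- Two points exchanged by one of the reflections have the same level only if they coincide. -/
lemma reflect_eq_of_level_eq (h : IsRoot ν m) {b : ℤ} (hb : b = 0 ∨ b = 1) {x : Lattice d}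
    (hx : level x = level (reflect ν m b x)) : reflect ν m b x = x := by
  have hp := h.offset_pos
  have hl := h.offset_lt
  rw [h.level_reflect, left_eq_add, mul_eq_zero] at hx
  rcases hx with hx | hx
  · rw [reflect, Int.cast_eq_zero.1 hx, zero_smul, add_zero]
  · rcases hb with rfl | rfl <;> push_cast at hx <;> linarith

lemma euclNorm_le_reflect (h : IsRoot ν m) {b : ℤ} (hb : b = 0 ∨ b = 1) {x : Lattice d}
    (hx : level x ≤ level (reflect ν m b x)) : euclNorm x ≤ euclNorm (reflect ν m b x) := by
  refine Real.sqrt_le_sqrt ?_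
  rw [h.sum_sq_reflect, le_add_iff_nonneg_right]
  rcases hb with rfl | rfl
  · simp
  · rw [h.level_le_reflect_one] at hx
    have : (0 : ℝ) ≤ ((1 - m x : ℤ) : ℝ) := by exact_mod_cast sub_nonneg.2 hx
    have h3 : (0 : ℝ) ≤ ∑ i, (ν i : ℝ) ^ 2 := Finset.sum_nonneg fun i _ => sq_nonneg _
    simpa using mul_nonneg this h3

/-- The linear part of the reflections permutes the steps. -/
lemma linear_involutive (h : IsRoot ν m) : Function.Involutive fun e => e - m e • ν := by
  intro e
  simp only [map_sub, map_zsmul, h.pairing_self, smul_eq_mul]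
  rw [sub_sub, ← add_smul]
  simp [show m e + (m e - m e * 2) = 0 by ring]

lemma reflect_add (b : ℤ) (x e : Lattice d) :
    reflect ν m b (x + e) = reflect ν m b x + (e - m e • ν) := by
  simp only [reflect, map_add, sub_add_eq_sub_sub, sub_smul]
  abel

/-- An edge with its ends strictly on different sides of the hyperplane `m = b` is reversed by the
reflection. -/
lemma reflect_eq_add_of_cross (h : IsRoot ν m) (b : ℤ) {x e : Lattice d} (he : e ∈ steps d)
    (hx : (b - m x) * (b - m (x + e)) < 0) : reflect ν m b x = x + e := by
  rw [map_add] at hx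
  rw [reflect, add_right_inj]
  rcases h.eq_of_step e he with h1 | rfl | rfl
  · rw [abs_le] at h1
    exfalso
    rcases mul_neg_iff.1 hx with ⟨h3, h4⟩ | ⟨h3, h4⟩ <;> omega
  · rw [h.pairing_self] at hx
    have : b - m x = 1 := by
      rcases mul_neg_iff.1 hx with ⟨h3, h4⟩ | ⟨h3, h4⟩ <;> omega
    rw [this, one_smul]
  · rw [map_neg, h.pairing_self] at hx
    have : b - m x = -1 := by
      rcases mul_neg_iff.1 hx with ⟨h3, h4⟩ | ⟨h3, h4⟩ <;> omega
    rw [this, neg_smul, one_smul]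

end IsRoot

lemma offset_pos (i : Fin d) : 0 < offset i := by unfold offset; positivity

lemma offset_lt_one (i : Fin d) : offset i < 1 := by
  unfold offset
  rw [div_lt_one (by positivity)]
  have : (0 : ℝ) ≤ (i : ℝ) := by positivity
  linarith

lemma offset_lt_offset {i j : Fin d} (h : i < j) : offset j < offset i := by
  unfold offset
  have : ((i : ℕ) : ℝ) < ((j : ℕ) : ℝ) := by exact_mod_cast h
  gcongr

lemma isRoot_unitVec (i : Fin d) :
    IsRoot (unitVec i) (2 • Pi.evalAddMonoidHom (fun _ : Fin d => ℤ) i) := by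
  have h0 := offset_pos i
  have h1 := offset_lt_one i
  refine ⟨?_, fun x => ?_, ⟨i, ?_⟩, ?_, ?_, fun e he => ?_, fun e he => ?_⟩
  · simp [unitVec]
  · simp [unitVec, Pi.single_apply, ite_pow]
  · simp [unitVec]
  · simpa [unitVec, Pi.single_apply, ite_pow] using h0
  · simpa [unitVec, Pi.single_apply, ite_pow] using h1
  · obtain ⟨k, rfl | rfl⟩ := mem_steps.1 he <;> rw [mem_steps] <;> refine ⟨k, ?_⟩ <;>
      by_cases hk : i = k
    · subst hk; right; ext l; simp [unitVec, Pi.single_apply]; split_ifs <;> simp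
    · left; ext l; simp [unitVec, Pi.single_apply, hk]
    · subst hk; left; ext l; simp [unitVec, Pi.single_apply]; split_ifs <;> simp
    · right; ext l; simp [unitVec, Pi.single_apply, hk]
  · obtain ⟨k, rfl | rfl⟩ := mem_steps.1 he <;> by_cases hk : i = k
    · simp [hk]
    · left; simp [unitVec, hk]
    · simp [hk]
    · left; simp [unitVec, hk]

lemma sum_sq_unitVec_add {i j : Fin d} (h : i ≠ j) :
    ∑ k, ((unitVec i + unitVec j : Lattice d) k) ^ 2 = 2 := by
  have : ∀ k, ((unitVec i + unitVec j : Lattice d) k) ^ 2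
      = (if k = i then 1 else 0) + (if k = j then 1 else 0) := by
    intro k
    simp only [unitVec, Pi.add_apply, Pi.single_apply]
    split_ifs <;> simp_all
  simp only [this, Finset.sum_add_distrib, Finset.sum_ite_eq', Finset.mem_univ, if_true]
  norm_num

lemma sum_sq_unitVec_sub {i j : Fin d} (h : i ≠ j) :
    ∑ k, ((unitVec i - unitVec j : Lattice d) k) ^ 2 = 2 := by
  have : ∀ k, ((unitVec i - unitVec j : Lattice d) k) ^ 2
      = (if k = i then 1 else 0) + (if k = j then 1 else 0) := by
    intro k
    simp only [unitVec, Pi.sub_apply, Pi.single_apply]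
    split_ifs <;> simp_all
  simp only [this, Finset.sum_add_distrib, Finset.sum_ite_eq', Finset.mem_univ, if_true]
  norm_num

lemma isRoot_add {i j : Fin d} (hij : i < j) :
    IsRoot (unitVec i + unitVec j)
      (Pi.evalAddMonoidHom (fun _ : Fin d => ℤ) i + Pi.evalAddMonoidHom _ j) := by
  have h0 := offset_pos i
  have h1 := offset_lt_one i
  have h2 := offset_pos j
  have h3 := offset_lt_one j
  have hne := hij.ne
  have hne' := hij.ne'
  have hN := sum_sq_unitVec_add hne
  have hα : ∑ k, offset k * (((unitVec i + unitVec j : Lattice d) k : ℤ) : ℝ)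
      = offset i + offset j := by
    simp [unitVec, Pi.single_apply, mul_add, Finset.sum_add_distrib]
  refine ⟨?_, fun x => ?_, ⟨i, ?_⟩, ?_, ?_, fun e he => ?_, fun e he => ?_⟩
  · simp [unitVec, hne, hne']
  · rw [hN]
    simp [unitVec, Pi.single_apply, add_mul, Finset.sum_add_distrib]
  · simp [unitVec, hne]
  · rw [hα]; linarith
  · rw [hα]
    have : ∑ k, (((unitVec i + unitVec j : Lattice d) k : ℤ) : ℝ) ^ 2 = 2 := by exact_mod_cast hN
    rw [this]; linarith
  · obtain ⟨k, hk⟩ := mem_steps.1 he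
    rw [mem_steps]
    by_cases hki : k = i
    · subst hki
      refine ⟨j, ?_⟩
      rcases hk with rfl | rfl
      · right; ext l; simp [unitVec, Pi.single_apply, hne]
      · left; ext l; simp [unitVec, Pi.single_apply, hne]
    · by_cases hkj : k = j
      · subst hkj
        refine ⟨i, ?_⟩
        rcases hk with rfl | rfl
        · right; ext l; simp [unitVec, Pi.single_apply, hne']
        · left; ext l; simp [unitVec, Pi.single_apply, hne']
      · refine ⟨k, ?_⟩
        rcases hk with rfl | rfl
        · left; ext l; simp [unitVec, Pi.single_apply, Ne.symm hki, Ne.symm hkj]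
        · right; ext l; simp [unitVec, Pi.single_apply, Ne.symm hki, Ne.symm hkj]
  · left
    obtain ⟨k, rfl | rfl⟩ := mem_steps.1 he <;>
      simp only [unitVec, AddMonoidHom.add_apply, Pi.evalAddMonoidHom_apply, Pi.single_apply,
        Pi.neg_apply] <;> split_ifs <;> simp_all

lemma isRoot_sub {i j : Fin d} (hij : i < j) :
    IsRoot (unitVec i - unitVec j)
      (Pi.evalAddMonoidHom (fun _ : Fin d => ℤ) i - Pi.evalAddMonoidHom _ j) := by
  have h1 := offset_lt_one i
  have h2 := offset_pos j
  have h3 := offset_lt_offset hij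
  have hne := hij.ne
  have hne' := hij.ne'
  have hN := sum_sq_unitVec_sub hne
  have hα : ∑ k, offset k * (((unitVec i - unitVec j : Lattice d) k : ℤ) : ℝ)
      = offset i - offset j := by
    simp [unitVec, Pi.single_apply, mul_sub, Finset.sum_sub_distrib]
  refine ⟨?_, fun x => ?_, ⟨i, ?_⟩, ?_, ?_, fun e he => ?_, fun e he => ?_⟩
  · simp [unitVec, hne, hne']
  · rw [hN]
    simp [unitVec, Pi.single_apply, sub_mul, Finset.sum_sub_distrib]
  · simp [unitVec, hne]
  · rw [hα]; linarith
  · rw [hα]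
    have : ∑ k, (((unitVec i - unitVec j : Lattice d) k : ℤ) : ℝ) ^ 2 = 2 := by exact_mod_cast hN
    rw [this]; linarith
  · obtain ⟨k, hk⟩ := mem_steps.1 he
    rw [mem_steps]
    by_cases hki : k = i
    · subst hki
      refine ⟨j, ?_⟩
      rcases hk with rfl | rfl
      · left; ext l; simp [unitVec, Pi.single_apply, hne]
      · right; ext l; simp [unitVec, Pi.single_apply, hne]; ring
    · by_cases hkj : k = j
      · subst hkj
        refine ⟨i, ?_⟩
        rcases hk with rfl | rfl
        · left; ext l; simp [unitVec, Pi.single_apply, hne']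
        · right; ext l; simp [unitVec, Pi.single_apply, hne']; ring
      · refine ⟨k, ?_⟩
        rcases hk with rfl | rfl
        · left; ext l; simp [unitVec, Pi.single_apply, Ne.symm hki, Ne.symm hkj]
        · right; ext l; simp [unitVec, Pi.single_apply, Ne.symm hki, Ne.symm hkj]
  · left
    obtain ⟨k, rfl | rfl⟩ := mem_steps.1 he <;>
      simp only [unitVec, AddMonoidHom.sub_apply, Pi.evalAddMonoidHom_apply, Pi.single_apply,
        Pi.neg_apply] <;> split_ifs <;> simp_all

/-- Every direction is `ν / |ν|²` for a root `ν`. -/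
lemma exists_root_of_mem_directions {e : Fin d → ℝ} (he : e ∈ directions d) :
    ∃ ν m, IsRoot (d := d) ν m ∧ ∀ i, (ν i : ℝ) = (∑ k, (ν k : ℝ) ^ 2) * e i := by
  simp only [directions, List.mem_append, List.mem_map, List.mem_finRange, true_and,
    List.mem_flatMap, List.mem_filter, decide_eq_true_eq, List.mem_cons, List.not_mem_nil,
    or_false] at he
  rcases he with ⟨i, rfl⟩ | ⟨i, j, hij, rfl | rfl⟩
  · refine ⟨_, _, isRoot_unitVec i, fun k => ?_⟩
    simp [unitVec, realUnitVec, Pi.single_apply, ite_pow]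
  · refine ⟨_, _, isRoot_add hij, fun k => ?_⟩
    have hN : ∑ k, (((unitVec i + unitVec j : Lattice d) k : ℤ) : ℝ) ^ 2 = 2 := by
      exact_mod_cast sum_sq_unitVec_add hij.ne
    rw [hN]
    simp [unitVec, realUnitVec, Pi.single_apply]
  · refine ⟨_, _, isRoot_sub hij, fun k => ?_⟩
    have hN : ∑ k, (((unitVec i - unitVec j : Lattice d) k : ℤ) : ℝ) ^ 2 = 2 := by
      exact_mod_cast sum_sq_unitVec_sub hij.ne
    rw [hN]
    simp [unitVec, realUnitVec, Pi.single_apply]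

end

section

/-! ### Functions fixed by all one-step rearrangements -/

/-- Every reflection that moves a point away from the centre does not increase the value there. -/
def ReflectionSymmetric {d : ℕ} (u : Lattice d → ℝ) : Prop :=
  ∀ ν m, IsRoot (d := d) ν m → ∀ b : ℤ, b = 0 ∨ b = 1 → ∀ x,
    level x ≤ level (reflect ν m b x) → u (reflect ν m b x) ≤ u x

/-- `rank (z / 2)`, for an integer `z`. -/
def intRank (z : ℤ) : ℕ := if 0 < z then z.toNat else (1 - z).toNat

/-- The point of rank one more than `x` on the line through `x`. -/
def nextPoint {d : ℕ} (ν : Lattice d) (m : Lattice d →+ ℤ) (x : Lattice d) : Lattice d :=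
  if 0 < m x then reflect ν m 0 x else reflect ν m 1 x

variable {d : ℕ} {ν : Lattice d} {m : Lattice d →+ ℤ}

lemma rank_half (z : ℤ) : rank ((z : ℝ) / 2) = intRank z := by
  unfold rank intRank
  have h : (0 : ℝ) < (z : ℝ) / 2 ↔ 0 < z := by
    rw [div_pos_iff_of_pos_right two_pos]; exact Int.cast_pos
  simp only [h]
  have h2 : 2 * ((z : ℝ) / 2) = (z : ℤ) := by ring
  have h3 : 1 - 2 * ((z : ℝ) / 2) = ((1 - z : ℤ) : ℝ) := by push_cast; ring
  split_ifs
  · rw [h2, ← Int.floor_toNat, Int.floor_intCast]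
  · rw [h3, ← Int.floor_toNat, Int.floor_intCast]

lemma intRank_pos (z : ℤ) : 0 < intRank z := by
  unfold intRank; split_ifs <;> omega

/-- The `n`-th largest value on a set that is enumerated in decreasing order of the values. -/
lemma nthLargest_eq {u : Lattice d → ℝ} {V : Set (Lattice d)} {g : ℕ → Lattice d}
    (hinj : Function.Injective g) (hV : Set.range g = V) (hu : Antitone (u ∘ g)) (n : ℕ) :
    nthLargest u V (n + 1) = u (g n) := by
  refine IsGreatest.csSup_eq ⟨⟨(Finset.range (n + 1)).map ⟨g, hinj⟩, ?_, by simp, ?_⟩, ?_⟩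
  · rw [← hV]; simp
  · refine ⟨⟨g n, by simpa using ⟨n, le_rfl, rfl⟩, rfl⟩, ?_⟩
    rintro _ ⟨y, hy, rfl⟩
    simp only [Finset.coe_map, Function.Embedding.coeFn_mk, Set.mem_image, Finset.coe_range,
      Set.mem_Iio] at hy
    obtain ⟨k, hk, rfl⟩ := hy
    exact hu (Nat.lt_succ_iff.1 hk)
  · rintro a ⟨Ω, hΩ, hcard, ha⟩
    -- A set of `n + 1` points cannot consist of the first `n` points of the enumeration only.
    obtain ⟨y, hy, hyn⟩ : ∃ y ∈ Ω, y ∉ (Finset.range n).map ⟨g, hinj⟩ := by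
      by_contra! h
      have := Finset.card_le_card (show Ω ⊆ _ from h)
      simp only [Finset.card_map, Finset.card_range] at this
      omega
    obtain ⟨k, rfl⟩ : y ∈ Set.range g := by rw [hV]; exact hΩ hy
    have hk : n ≤ k := by
      by_contra! h
      exact hyn (by simpa [hinj.eq_iff] using h)
    exact (ha.2 ⟨g k, hy, rfl⟩).trans (hu hk)

namespace IsRoot

lemma intRank_nextPoint (h : IsRoot ν m) (x : Lattice d) :
    intRank (m (nextPoint ν m x)) = intRank (m x) + 1 := by
  unfold nextPoint intRank
  split_ifs with h1 h2 h2 <;> rw [h.map_reflect] at * <;> omega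

lemma apply_nextPoint_le (h : IsRoot ν m) {u : Lattice d → ℝ} (hu : ReflectionSymmetric u)
    (x : Lattice d) : u (nextPoint ν m x) ≤ u x := by
  unfold nextPoint
  split_ifs with h1
  · exact hu ν m h 0 (Or.inl rfl) x ((h.level_le_reflect_zero x).2 h1.le)
  · exact hu ν m h 1 (Or.inr rfl) x ((h.level_le_reflect_one x).2 (by omega))

lemma nextPoint_eq_add (x : Lattice d) : ∃ k : ℤ, nextPoint ν m x = x + k • ν := by
  unfold nextPoint reflect
  split_ifs
  · exact ⟨_, rfl⟩
  · exact ⟨_, rfl⟩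

/-- The points of a line in direction `ν`, in the order of their ranks; the values of a reflection
symmetric function decrease along this enumeration. -/
lemma exists_enumeration (h : IsRoot ν m) (x : Lattice d) :
    ∃ g : ℕ → Lattice d, Function.Injective g ∧ Set.range g = {y | ∃ k : ℤ, y = x + k • ν} ∧
      g (intRank (m x) - 1) = x ∧ ∀ u, ReflectionSymmetric u → Antitone (u ∘ g) := by
  set x₀ : Lattice d := x + (-(m x / 2)) • ν with hx₀
  have hm₀ : m x₀ = m x % 2 := by
    rw [hx₀, map_add, map_zsmul, h.pairing_self, smul_eq_mul]; omega
  set g : ℕ → Lattice d := fun n => (nextPoint ν m)^[n] x₀ with hg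
  have hsucc : ∀ n, g (n + 1) = nextPoint ν m (g n) := fun n =>
    Function.iterate_succ_apply' _ _ _
  have hrk : ∀ n, intRank (m (g n)) = n + 1 := by
    intro n
    induction n with
    | zero =>
      change intRank (m x₀) = 1
      rw [hm₀, intRank]
      split_ifs <;> omega
    | succ n ih => rw [hsucc, h.intRank_nextPoint, ih]
  have hline : ∀ n, ∃ k : ℤ, g n = x + k • ν := by
    intro n
    induction n with
    | zero => exact ⟨_, hx₀⟩
    | succ n ih =>
      obtain ⟨k, hk⟩ := ih
      obtain ⟨l, hl⟩ := nextPoint_eq_add (ν := ν) (m := m) (g n)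
      exact ⟨k + l, by rw [hsucc, hl, hk, add_smul, add_assoc]⟩
  have heq : ∀ k : ℤ, g (intRank (m (x + k • ν)) - 1) = x + k • ν := by
    intro k
    obtain ⟨l, hl⟩ := hline (intRank (m (x + k • ν)) - 1)
    have h1 := hrk (intRank (m (x + k • ν)) - 1)
    have h2 := intRank_pos (m (x + k • ν))
    rw [Nat.sub_add_cancel h2, hl] at h1
    simp only [map_add, map_zsmul, h.pairing_self, smul_eq_mul, intRank] at h1
    have : l = k := by split_ifs at h1 <;> omega
    rw [hl, this]
  refine ⟨g, fun a b hab => ?_, ?_, ?_, fun u hu => antitone_nat_of_succ_le fun n => ?_⟩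
  · have := hrk a
    rw [hab, hrk b] at this
    omega
  · ext y
    constructor
    · rintro ⟨n, rfl⟩
      exact hline n
    · rintro ⟨k, rfl⟩
      exact ⟨_, heq k⟩
  · simpa using heq 0
  · simp only [Function.comp_apply, hsucc]
    exact h.apply_nextPoint_le hu _

end IsRoot

theorem ReflectionSymmetric.oneStep_eq {u : Lattice d → ℝ} (hu : ReflectionSymmetric u)
    {e : Fin d → ℝ} (he : e ∈ directions d) : oneStep e u = u := by
  obtain ⟨ν, m, h, hν⟩ := exists_root_of_mem_directions he
  obtain ⟨i₀, hi₀⟩ := h.exists_one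
  have hN : (∑ k, (ν k : ℝ) ^ 2) ≠ 0 := by
    intro h0
    have := hν i₀
    rw [h0, hi₀] at this
    simp at this
  funext x
  have hpos : position e x = (m x : ℝ) / 2 := by
    have h1 := h.inner_eq_real x
    have h2 : ∑ i, (ν i : ℝ) * (x i : ℝ) = (∑ k, (ν k : ℝ) ^ 2) * position e x := by
      rw [position, Finset.mul_sum]
      refine Finset.sum_congr rfl fun i _ => ?_
      rw [hν i]; ring
    rw [h2] at h1
    have := mul_left_cancel₀ hN (h1.trans (by ring :
      _ = (∑ k, (ν k : ℝ) ^ 2) * (2 * position e x)))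
    linarith
  have hline : line e x = {y | ∃ k : ℤ, y = x + k • ν} := by
    ext y
    constructor
    · rintro ⟨s, hs⟩
      refine ⟨y i₀ - x i₀, funext fun i => ?_⟩
      have h1 := hs i₀
      have h2 := hs i
      have h3 := hν i₀
      have h4 := hν i
      rw [hi₀, Int.cast_one] at h3
      have : ((y i - x i : ℤ) : ℝ) = ((y i₀ - x i₀ : ℤ) : ℝ) * (ν i : ℝ) := by
        rw [h1, h2, h4]
        linear_combination (s * e i) * h3
      have h5 : y i - x i = (y i₀ - x i₀) * ν i := by exact_mod_cast this
      simp only [Pi.add_apply, Pi.smul_apply, smul_eq_mul]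
      linarith
    · rintro ⟨k, rfl⟩
      refine ⟨k * ∑ k, (ν k : ℝ) ^ 2, fun i => ?_⟩
      rw [mul_assoc, ← hν i]
      simp
  obtain ⟨g, hinj, hrange, hgx, hanti⟩ := h.exists_enumeration x
  have hr : rank (position e x) = intRank (m x) - 1 + 1 := by
    rw [hpos, rank_half]
    have := intRank_pos (m x)
    omega
  rw [oneStep, hr, nthLargest_eq hinj (hrange.trans hline.symm) (hanti u hu), hgx]

theorem ReflectionSymmetric.isSchwarzSymmetric {u : Lattice d → ℝ} (hu : ReflectionSymmetric u)
    (hd : 1 ≤ d) (hadm : Admissible u) : IsSchwarzSymmetric u := by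
  refine ⟨hadm, fun L hL x => ?_⟩
  have hlen : 0 < L.length := by
    rw [hL.length_eq]
    simp only [directions, List.length_append, List.length_map, List.length_finRange]
    omega
  have : ∀ k, iterRearr L u k = u := by
    intro k
    induction k with
    | zero => rfl
    | succ k ih =>
      rw [iterRearr, ih]
      refine hu.oneStep_eq (hL.subset ?_)
      rw [List.getD_eq_getElem _ _ (Nat.mod_lt _ hlen)]
      exact List.getElem_mem _
  simp only [this]
  exact tendsto_const_nhds

/-- Decay of reflection symmetric functions: at least `2 |x i|` points of the line through `x` in
direction `e_i` carry values not below `u x`. -/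
theorem ReflectionSymmetric.mul_sq_le {u : Lattice d → ℝ} (hu : ReflectionSymmetric u)
    (h0 : ∀ x, 0 ≤ u x) {C : ℝ} (hC : ∀ S : Finset (Lattice d), ∑ x ∈ S, u x ^ 2 ≤ C)
    (x : Lattice d) (i : Fin d) : 2 * |(x i : ℝ)| * u x ^ 2 ≤ C := by
  obtain ⟨g, hinj, -, hgx, hanti⟩ := (isRoot_unitVec i).exists_enumeration x
  set r := intRank ((2 • Pi.evalAddMonoidHom (fun _ : Fin d => ℤ) i) x) with hr
  have hr0 : 0 < r := intRank_pos _
  have hrx : 2 * |(x i : ℝ)| ≤ r := by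
    have : 2 * |x i| ≤ (r : ℤ) := by
      rw [hr, intRank]
      simp only [AddMonoidHom.smul_apply, Pi.evalAddMonoidHom_apply, nsmul_eq_mul,
        Nat.cast_ofNat]
      split_ifs <;> rcases abs_cases (x i) with ⟨h1, h2⟩ | ⟨h1, h2⟩ <;> omega
    exact_mod_cast this
  have hle : ∀ k ∈ Finset.range r, u x ^ 2 ≤ u (g k) ^ 2 := by
    intro k hk
    have : u (g (r - 1)) ≤ u (g k) := hanti u hu (by have := Finset.mem_range.1 hk; omega)
    rw [hgx] at this
    exact pow_le_pow_left₀ (h0 x) this 2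
  calc 2 * |(x i : ℝ)| * u x ^ 2 ≤ r * u x ^ 2 := by gcongr
    _ = ∑ k ∈ Finset.range r, u x ^ 2 := by simp
    _ ≤ ∑ k ∈ Finset.range r, u (g k) ^ 2 := Finset.sum_le_sum hle
    _ = ∑ y ∈ (Finset.range r).map ⟨g, hinj⟩, u y ^ 2 := by simp
    _ ≤ C := hC _

end

section

/-! ### Polarization -/

/-- The polarization of `u` in the reflection `reflect ν m b`: of the two values on an orbit, the
larger one is put at the point of smaller level. -/
noncomputable def polarize {d : ℕ} (ν : Lattice d) (m : Lattice d →+ ℤ) (b : ℤ)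
    (u : Lattice d → ℝ) (x : Lattice d) : ℝ :=
  if level x ≤ level (reflect ν m b x) then max (u x) (u (reflect ν m b x))
  else min (u x) (u (reflect ν m b x))

/-- `∑_x ∑_{y ∼ x} u(x) u(y)`, arranged by the step `y - x`. -/
noncomputable def edgeSum {d : ℕ} (u : Lattice d → ℝ) : ℝ :=
  ∑ e ∈ steps d, ∑' x, u x * u (x + e)

/-- A positive weight that is strictly decreasing in the level. -/
noncomputable def weight {d : ℕ} (x : Lattice d) : ℝ := 1 / (1 + level x)

variable {d : ℕ} {ν : Lattice d} {m : Lattice d →+ ℤ}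

lemma level_term_nonneg (x : Lattice d) (i : Fin d) :
    0 ≤ (x i : ℝ) ^ 2 - offset i * (x i : ℝ) := by
  have h0 := offset_pos i
  have h1 := offset_lt_one i
  rcases le_or_gt (x i) 0 with h | h
  · have : (x i : ℝ) ≤ 0 := by exact_mod_cast h
    nlinarith
  · have : (1 : ℝ) ≤ (x i : ℝ) := by exact_mod_cast h
    nlinarith

lemma level_nonneg (x : Lattice d) : 0 ≤ level x :=
  Finset.sum_nonneg fun i _ => level_term_nonneg x i

lemma weight_pos (x : Lattice d) : 0 < weight x := by
  have := level_nonneg x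
  unfold weight; positivity

lemma weight_le_one (x : Lattice d) : weight x ≤ 1 := by
  have := level_nonneg x
  unfold weight
  rw [div_le_one (by linarith)]
  linarith

lemma weight_lt_weight {x y : Lattice d} (h : level x < level y) : weight y < weight x := by
  have := level_nonneg x
  unfold weight
  exact one_div_lt_one_div_of_lt (by linarith) (by linarith)

section Pairing

variable {X : Type*} {f g : X → ℝ}

lemma tsum_eq_half_tsum_add_perm (T : Equiv.Perm X) (hf : Summable f) :
    ∑' x, f x = (1 / 2) * ∑' x, (f x + f (T x)) := by
  have h : Summable fun x => f (T x) := (Equiv.summable_iff T).2 hf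
  rw [hf.tsum_add h, Equiv.tsum_eq T f]
  ring

lemma summable_add_perm (T : Equiv.Perm X) (hf : Summable f) :
    Summable fun x => f x + f (T x) :=
  hf.add ((Equiv.summable_iff T).2 hf)

lemma tsum_le_tsum_of_add_perm (T : Equiv.Perm X) (hf : Summable f) (hg : Summable g)
    (h : ∀ x, f x + f (T x) ≤ g x + g (T x)) : ∑' x, f x ≤ ∑' x, g x := by
  rw [tsum_eq_half_tsum_add_perm T hf, tsum_eq_half_tsum_add_perm T hg]
  have := (summable_add_perm T hf).tsum_le_tsum h (summable_add_perm T hg)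
  linarith

lemma tsum_lt_tsum_of_add_perm (T : Equiv.Perm X) (hf : Summable f) (hg : Summable g)
    (h : ∀ x, f x + f (T x) ≤ g x + g (T x)) {x₀ : X}
    (h₀ : f x₀ + f (T x₀) < g x₀ + g (T x₀)) : ∑' x, f x < ∑' x, g x := by
  rw [tsum_eq_half_tsum_add_perm T hf, tsum_eq_half_tsum_add_perm T hg]
  have := Summable.tsum_lt_tsum h h₀ (summable_add_perm T hf) (summable_add_perm T hg)
  linarith

end Pairing

namespace IsRoot

variable {b : ℤ} {u : Lattice d → ℝ}

lemma polarize_of_level_le (h : IsRoot ν m) (hb : b = 0 ∨ b = 1) {x : Lattice d}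
    (hx : level x ≤ level (reflect ν m b x)) :
    polarize ν m b u x = max (u x) (u (reflect ν m b x)) ∧
      polarize ν m b u (reflect ν m b x) = min (u x) (u (reflect ν m b x)) := by
  refine ⟨if_pos hx, ?_⟩
  rw [polarize, h.reflect_involutive b x]
  split_ifs with h1
  · rw [h.reflect_eq_of_level_eq hb (le_antisymm hx h1), max_self, min_self]
  · exact min_comm _ _

/-- To compare `f x + f (τ x)` with `g x + g (τ x)` one may assume that `x` is on the inner side of
the hyperplane. -/
lemma forall_add_le (h : IsRoot ν m) (b : ℤ) {f g : Lattice d → ℝ}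
    (hfg : ∀ x, level x ≤ level (reflect ν m b x) →
      f x + f (reflect ν m b x) ≤ g x + g (reflect ν m b x)) (x : Lattice d) :
    f x + f (h.perm b x) ≤ g x + g (h.perm b x) := by
  change f x + f (reflect ν m b x) ≤ g x + g (reflect ν m b x)
  rcases le_total (level x) (level (reflect ν m b x)) with hx | hx
  · exact hfg x hx
  · have := hfg (reflect ν m b x) (by rwa [h.reflect_involutive b x])
    rw [h.reflect_involutive b x] at this
    linarith

lemma polarize_nonneg (hu : ∀ x, 0 ≤ u x) (x : Lattice d) : 0 ≤ polarize ν m b u x := by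
  unfold polarize
  split_ifs
  · exact le_max_of_le_left (hu x)
  · exact le_min (hu x) (hu _)

/-- Polarization does not enlarge the sublevel set of `level` that supports the function. -/
lemma polarize_eq_zero (hu : ∀ x, 0 ≤ u x) {R : ℝ} (hR : ∀ x, R < level x → u x = 0)
    {x : Lattice d} (hx : R < level x) : polarize ν m b u x = 0 := by
  unfold polarize
  split_ifs with h
  · rw [hR x hx, hR _ (hx.trans_le h), max_self]
  · rw [hR x hx, min_eq_left (hu _)]

lemma tsum_polarize_sq_le (h : IsRoot ν m) (hb : b = 0 ∨ b = 1)
    (hu : Summable fun x => u x ^ 2) (hv : Summable fun x => polarize ν m b u x ^ 2) :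
    ∑' x, polarize ν m b u x ^ 2 ≤ ∑' x, u x ^ 2 := by
  refine tsum_le_tsum_of_add_perm (h.perm b) hv hu (h.forall_add_le b fun x hx => ?_)
  obtain ⟨h1, h2⟩ := h.polarize_of_level_le (u := u) hb hx
  rw [h1, h2]
  rcases le_total (u x) (u (reflect ν m b x)) with h3 | h3
  · rw [max_eq_right h3, min_eq_left h3, add_comm]
  · rw [max_eq_left h3, min_eq_right h3]

lemma weight_sum_lt_polarize (h : IsRoot ν m) (hb : b = 0 ∨ b = 1) (hu0 : ∀ x, 0 ≤ u x)
    (hu : Summable fun x => weight x * u x ^ 2)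
    (hv : Summable fun x => weight x * polarize ν m b u x ^ 2) {x₀ : Lattice d}
    (hx₀ : level x₀ ≤ level (reflect ν m b x₀)) (hlt : u x₀ < u (reflect ν m b x₀)) :
    ∑' x, weight x * u x ^ 2 < ∑' x, weight x * polarize ν m b u x ^ 2 := by
  refine tsum_lt_tsum_of_add_perm (h.perm b) hu hv (h.forall_add_le b fun x hx => ?_)
    (x₀ := x₀) ?_
  · obtain ⟨h1, h2⟩ := h.polarize_of_level_le (u := u) hb hx
    rw [h1, h2]
    rcases le_total (u x) (u (reflect ν m b x)) with h3 | h3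
    · rw [max_eq_right h3, min_eq_left h3]
      have hw : weight (reflect ν m b x) ≤ weight x := by
        rcases hx.eq_or_lt with h4 | h4
        · rw [weight, weight, h4]
        · exact (weight_lt_weight h4).le
      have := pow_le_pow_left₀ (hu0 x) h3 2
      nlinarith
    · rw [max_eq_left h3, min_eq_right h3]
  · change weight x₀ * u x₀ ^ 2 + weight (reflect ν m b x₀) * u (reflect ν m b x₀) ^ 2
      < weight x₀ * polarize ν m b u x₀ ^ 2
        + weight (reflect ν m b x₀) * polarize ν m b u (reflect ν m b x₀) ^ 2
    obtain ⟨h1, h2⟩ := h.polarize_of_level_le (u := u) hb hx₀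
    rw [h1, h2, max_eq_right hlt.le, min_eq_left hlt.le]
    have hw : weight (reflect ν m b x₀) < weight x₀ := by
      refine weight_lt_weight (lt_of_le_of_ne hx₀ fun h4 => ?_)
      rw [h.reflect_eq_of_level_eq hb h4] at hlt
      exact lt_irrefl _ hlt
    have := pow_lt_pow_left₀ hlt (hu0 x₀) two_ne_zero
    nlinarith

lemma nonlinear_sum_le_polarize (h : IsRoot ν m) (hb : b = 0 ∨ b = 1) (hu0 : ∀ x, 0 ≤ u x)
    {F : ℝ → ℝ → ℝ} (hF : Supermodular fun r t => -F r t)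
    (hu : Summable fun x => F (euclNorm x) (u x))
    (hv : Summable fun x => F (euclNorm x) (polarize ν m b u x)) :
    ∑' x, F (euclNorm x) (u x) ≤ ∑' x, F (euclNorm x) (polarize ν m b u x) := by
  refine tsum_le_tsum_of_add_perm (h.perm b) hu hv (h.forall_add_le b fun x hx => ?_)
  obtain ⟨h1, h2⟩ := h.polarize_of_level_le (u := u) hb hx
  rw [h1, h2]
  rcases le_total (u x) (u (reflect ν m b x)) with h3 | h3
  · rw [max_eq_right h3, min_eq_left h3]
    have h4 := h.euclNorm_le_reflect hb hx
    have := hF (euclNorm x) (u x) (euclNorm (reflect ν m b x) - euclNorm x)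
      (u (reflect ν m b x) - u x) (Real.sqrt_nonneg _) (hu0 x) (sub_nonneg.2 h4)
      (sub_nonneg.2 h3)
    simp only [add_sub_cancel] at this
    linarith
  · rw [max_eq_left h3, min_eq_right h3]

/-- The four values of `u` on an edge and on its mirror image contribute more to the edge sum after
polarization: if the edge stays on one side, by the rearrangement inequality; if it crosses, the
reflection exchanges its ends and nothing changes. -/
lemma edge_le_polarize (h : IsRoot ν m) (hb : b = 0 ∨ b = 1) {e : Lattice d} (he : e ∈ steps d)
    (x : Lattice d) :
    u x * u (x + e) + u (reflect ν m b x) * u (reflect ν m b (x + e)) ≤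
      polarize ν m b u x * polarize ν m b u (x + e) +
        polarize ν m b u (reflect ν m b x) * polarize ν m b u (reflect ν m b (x + e)) := by
  have hrearr : ∀ p q r s : ℝ, p * q + r * s ≤ max p r * max q s + min p r * min q s := by
    intro p q r s
    rcases le_total p r with h1 | h1 <;> rcases le_total q s with h2 | h2 <;>
      simp only [h1, h2, max_eq_left, max_eq_right, min_eq_left, min_eq_right] <;> nlinarith
  have hcross : ∀ y z, polarize ν m b u y * polarize ν m b u (reflect ν m b y)
      = u y * u (reflect ν m b y) → z = reflect ν m b y →
      u y * u z + u (reflect ν m b y) * u (reflect ν m b z) ≤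
      polarize ν m b u y * polarize ν m b u z +
        polarize ν m b u (reflect ν m b y) * polarize ν m b u (reflect ν m b z) := by
    rintro y z hy rfl
    rw [h.reflect_involutive b y, hy]
    linarith
  have hprod : ∀ y, polarize ν m b u y * polarize ν m b u (reflect ν m b y)
      = u y * u (reflect ν m b y) := by
    intro y
    rcases le_total (level y) (level (reflect ν m b y)) with hy | hy
    · obtain ⟨h1, h2⟩ := h.polarize_of_level_le (u := u) hb hy
      rw [h1, h2, mul_comm, min_mul_max]
    · obtain ⟨h1, h2⟩ := h.polarize_of_level_le (u := u) (x := reflect ν m b y) hb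
        (by rwa [h.reflect_involutive b y])
      rw [h.reflect_involutive b y] at h1 h2
      rw [h1, h2, min_mul_max, mul_comm]
  have hsign : ∀ y z, level y < level (reflect ν m b y) → level (reflect ν m b z) < level z →
      (b - m y) * (b - m z) < 0 := by
    intro y z hy hz
    rw [h.level_reflect] at hy hz
    have hy' := lt_add_iff_pos_right _ |>.1 hy
    have hz' := add_lt_iff_neg_left.1 hz
    have h1 := mul_neg_of_pos_of_neg hy' hz'
    have h2 : ((b - m y : ℤ) : ℝ) * ((b - m z : ℤ) : ℝ) < 0 := by
      by_contra! h3
      have := mul_nonneg h3 (sq_nonneg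
        (b * (∑ i, (ν i : ℝ) ^ 2) - ∑ i, offset i * (ν i : ℝ)))
      linarith
    exact_mod_cast h2
  rcases le_or_gt (level x) (level (reflect ν m b x)) with hx | hx <;>
    rcases le_or_gt (level (x + e)) (level (reflect ν m b (x + e))) with hy | hy
  · obtain ⟨h1, h2⟩ := h.polarize_of_level_le (u := u) hb hx
    obtain ⟨h3, h4⟩ := h.polarize_of_level_le (u := u) hb hy
    rw [h1, h2, h3, h4]
    exact hrearr _ _ _ _
  · rcases hx.eq_or_lt with hx | hx
    · obtain ⟨h1, h2⟩ := h.polarize_of_level_le (u := u) hb hx.le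
      obtain ⟨h3, h4⟩ := h.polarize_of_level_le (u := u) (x := reflect ν m b (x + e)) hb
        (by rw [h.reflect_involutive b]; exact hy.le)
      rw [h.reflect_involutive b] at h3 h4
      rw [h1, h2, h3, h4, h.reflect_eq_of_level_eq hb hx, max_self, min_self]
      rcases le_total (u (x + e)) (u (reflect ν m b (x + e))) with h5 | h5
      · rw [max_eq_left h5, min_eq_right h5]
      · rw [max_eq_right h5, min_eq_left h5, add_comm]
    · exact hcross x _ (hprod x) (h.reflect_eq_add_of_cross b he (hsign _ _ hx hy)).symm
  · rcases hy.eq_or_lt with hy | hy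
    · obtain ⟨h1, h2⟩ := h.polarize_of_level_le (u := u) hb hy.le
      obtain ⟨h3, h4⟩ := h.polarize_of_level_le (u := u) (x := reflect ν m b x) hb
        (by rw [h.reflect_involutive b]; exact hx.le)
      rw [h.reflect_involutive b] at h3 h4
      rw [h1, h2, h3, h4, h.reflect_eq_of_level_eq hb hy, max_self, min_self]
      rcases le_total (u x) (u (reflect ν m b x)) with h5 | h5
      · rw [max_eq_left h5, min_eq_right h5]
      · rw [max_eq_right h5, min_eq_left h5, add_comm]
    · exact hcross x _ (hprod x) (h.reflect_eq_add_of_cross b he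
        (by rw [mul_comm]; exact hsign _ _ hy hx)).symm
  · obtain ⟨h1, h2⟩ := h.polarize_of_level_le (u := u) (x := reflect ν m b x) hb
        (by rw [h.reflect_involutive b]; exact hx.le)
    obtain ⟨h3, h4⟩ := h.polarize_of_level_le (u := u) (x := reflect ν m b (x + e)) hb
        (by rw [h.reflect_involutive b]; exact hy.le)
    rw [h.reflect_involutive b] at h1 h2 h3 h4
    rw [h1, h2, h3, h4]
    have := hrearr (u (reflect ν m b x)) (u (reflect ν m b (x + e))) (u x) (u (x + e))
    linarith

lemma edgeSum_le_polarize (h : IsRoot ν m) (hb : b = 0 ∨ b = 1)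
    (hu : ∀ e, Summable fun x => u x * u (x + e))
    (hv : ∀ e, Summable fun x => polarize ν m b u x * polarize ν m b u (x + e)) :
    edgeSum u ≤ edgeSum (polarize ν m b u) := by
  -- The edge sum is unchanged when every edge is replaced by its mirror image.
  have hsymm : ∀ w : Lattice d → ℝ, edgeSum w =
      ∑ e ∈ steps d, ∑' x, w (reflect ν m b x) * w (reflect ν m b (x + e)) := by
    intro w
    have : ∀ e, ∑' x, w (reflect ν m b x) * w (reflect ν m b (x + e))
        = ∑' x, w x * w (x + (e - m e • ν)) := by
      intro e
      rw [← Equiv.tsum_eq (h.perm b) fun x => w x * w (x + (e - m e • ν))]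
      refine tsum_congr fun x => ?_
      change _ = w (reflect ν m b x) * w (reflect ν m b x + (e - m e • ν))
      rw [reflect_add]
    simp only [this]
    refine Finset.sum_nbij' (fun e => e - m e • ν) (fun e => e - m e • ν) h.map_steps h.map_steps
      (fun e _ => h.linear_involutive e) (fun e _ => h.linear_involutive e) fun e _ => ?_
    rw [show (e - m e • ν) - m (e - m e • ν) • ν = e from h.linear_involutive e]
  have hdouble : ∀ w : Lattice d → ℝ, (∀ e, Summable fun x => w x * w (x + e)) →
      2 * edgeSum w = ∑ e ∈ steps d, ∑' x, (w x * w (x + e) +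
        w (reflect ν m b x) * w (reflect ν m b (x + e))) ∧
      ∀ e, Summable fun x => w (reflect ν m b x) * w (reflect ν m b (x + e)) := by
    intro w hw
    have hs : ∀ e, Summable fun x => w (reflect ν m b x) * w (reflect ν m b (x + e)) := by
      intro e
      simp only [reflect_add]
      exact (Equiv.summable_iff (h.perm b)).2 (hw (e - m e • ν))
    refine ⟨?_, hs⟩
    rw [two_mul]
    nth_rw 2 [hsymm w]
    rw [edgeSum, ← Finset.sum_add_distrib]
    exact Finset.sum_congr rfl fun e _ => ((hw e).tsum_add (hs e)).symm
  obtain ⟨hu1, hu2⟩ := hdouble u hu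
  obtain ⟨hv1, hv2⟩ := hdouble _ hv
  have : 2 * edgeSum u ≤ 2 * edgeSum (polarize ν m b u) := by
    rw [hu1, hv1]
    exact Finset.sum_le_sum fun e he => ((hu e).add (hu2 e)).tsum_le_tsum
      (fun x => h.edge_le_polarize hb he x) ((hv e).add (hv2 e))
  linarith

end IsRoot

end

section

/-! ### Square summable functions on the lattice -/

variable {d : ℕ} {u : Lattice d → ℝ}

lemma localGradSq_eq_sum_steps (u : Lattice d → ℝ) (x : Lattice d) :
    localGradSq u x = ∑ e ∈ steps d, (u (x + e) - u x) ^ 2 := by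
  rw [sum_steps, localGradSq]
  simp [sq_abs, sub_eq_add_neg]

lemma summable_sq_add (hu : Summable fun x => u x ^ 2) (e : Lattice d) :
    Summable fun x => u (x + e) ^ 2 :=
  hu.comp_injective (i := fun x => x + e) (add_left_injective e)

lemma tsum_sq_add (u : Lattice d → ℝ) (e : Lattice d) :
    ∑' x, u (x + e) ^ 2 = ∑' x, u x ^ 2 :=
  Equiv.tsum_eq (Equiv.addRight e) fun x => u x ^ 2

lemma summable_mul_add (hu : Summable fun x => u x ^ 2) (e : Lattice d) :
    Summable fun x => u x * u (x + e) := by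
  refine Summable.of_norm_bounded (hu.add (summable_sq_add hu e)) fun x => ?_
  rw [Real.norm_eq_abs, abs_le]
  constructor <;> nlinarith [sq_nonneg (u x + u (x + e)), sq_nonneg (u x - u (x + e)),
    sq_nonneg (u x), sq_nonneg (u (x + e))]

lemma summable_localGradSq (hu : Summable fun x => u x ^ 2) : Summable (localGradSq u) := by
  have : localGradSq u = fun x => ∑ e ∈ steps d, (u (x + e) - u x) ^ 2 :=
    funext fun x => localGradSq_eq_sum_steps u x
  rw [this]
  refine summable_sum fun e _ => ?_
  have := ((summable_sq_add hu e).add hu).sub ((summable_mul_add hu e).mul_left 2)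
  refine this.congr fun x => ?_
  ring

lemma memH1_iff : MemH1 u ↔ Summable fun x => u x ^ 2 := by
  simp only [MemH1, sq_abs]
  exact ⟨fun h => h.1, fun h => ⟨h, summable_localGradSq h⟩⟩

lemma gradNormSq_eq (hu : Summable fun x => u x ^ 2) :
    gradNormSq u = 2 * d * ∑' x, u x ^ 2 - edgeSum u := by
  have h1 : ∑' x, localGradSq u x
      = ∑ e ∈ steps d, (2 * ∑' x, u x ^ 2 - 2 * ∑' x, u x * u (x + e)) := by
    simp only [localGradSq_eq_sum_steps]
    have hs : ∀ e, HasSum (fun x => (u (x + e) - u x) ^ 2)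
        (2 * ∑' x, u x ^ 2 - 2 * ∑' x, u x * u (x + e)) := by
      intro e
      have h2 := (summable_sq_add hu e).hasSum
      rw [tsum_sq_add] at h2
      have h3 := (h2.add hu.hasSum).sub ((summable_mul_add hu e).hasSum.mul_left 2)
      rw [← two_mul] at h3
      refine h3.congr_fun fun x => ?_
      ring
    exact (hasSum_sum fun e _ => hs e).tsum_eq
  rw [gradNormSq, h1, Finset.sum_sub_distrib, Finset.sum_const, nsmul_eq_mul, card_steps,
    ← Finset.mul_sum, edgeSum]
  ring

lemma edgeSum_le_edgeSum_abs (hu : Summable fun x => u x ^ 2) :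
    edgeSum u ≤ edgeSum fun x => |u x| := by
  have hu' : Summable fun x => |u x| ^ 2 := by simpa only [sq_abs] using hu
  refine Finset.sum_le_sum fun e _ => (summable_mul_add hu e).tsum_le_tsum (fun x => ?_)
    (summable_mul_add hu' e)
  rw [← abs_mul]
  exact le_abs_self _

/-! ### The nonlinear term -/

/-- The conditions on the nonlinearity, except for the lower bound at small arguments. -/
structure IsNonlinearity (d : ℕ) (F : ℝ → ℝ → ℝ) : Prop where
  nonneg : ∀ (x : Lattice d) (t : ℝ), 0 ≤ F (euclNorm x) t
  le_abs : ∀ (x : Lattice d) (t : ℝ), F (euclNorm x) t ≤ F (euclNorm x) |t|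
  cont : ∀ x : Lattice d, ContinuousOn (F (euclNorm x)) (Set.Ici 0)
  growth : ∃ K l : ℝ, 0 < K ∧ 0 < l ∧ ∀ (x : Lattice d) (t : ℝ), 0 ≤ t →
    F (euclNorm x) t ≤ K * (t ^ 2 + t ^ (l + 2))
  small : ∀ ε : ℝ, 0 < ε → ∃ X₀ t₀ : ℝ, 0 < X₀ ∧ 0 < t₀ ∧
    ∀ (x : Lattice d) (t : ℝ), X₀ < euclNorm x → |t| < t₀ → F (euclNorm x) t ≤ ε * t ^ 2
  supermodular : Supermodular fun r t => -F r t
  scale : ∀ (x : Lattice d) (θ t : ℝ), 1 ≤ θ → 0 ≤ t →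
    θ ^ 2 * F (euclNorm x) t ≤ F (euclNorm x) (θ * t)

namespace IsNonlinearity

variable {F : ℝ → ℝ → ℝ}

lemma zero (hF : IsNonlinearity d F) (x : Lattice d) : F (euclNorm x) 0 = 0 := by
  obtain ⟨K, l, hK, hl, h⟩ := hF.growth
  refine le_antisymm ?_ (hF.nonneg x 0)
  have := h x 0 le_rfl
  rw [Real.zero_rpow (by linarith)] at this
  simpa using this

lemma summable (hF : IsNonlinearity d F) (hu : Summable fun x => u x ^ 2) :
    Summable fun x => F (euclNorm x) (u x) := by
  obtain ⟨K, l, hK, hl, h⟩ := hF.growth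
  set S := ∑' x, u x ^ 2
  refine Summable.of_nonneg_of_le (fun x => hF.nonneg x _) (fun x => ?_)
    (hu.mul_left (K * (1 + √S ^ l)))
  have hb : |u x| ≤ √S := Real.abs_le_sqrt (hu.le_tsum x fun _ _ => sq_nonneg _)
  have h1 : |u x| ^ (l + 2) = |u x| ^ l * u x ^ 2 := by
    rw [Real.rpow_add_of_nonneg (abs_nonneg _) hl.le (by norm_num), ← sq_abs]
    norm_cast
  calc F (euclNorm x) (u x) ≤ F (euclNorm x) |u x| := hF.le_abs x _
    _ ≤ K * (|u x| ^ 2 + |u x| ^ (l + 2)) := h x _ (abs_nonneg _)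
    _ = K * (1 + |u x| ^ l) * u x ^ 2 := by rw [h1, sq_abs]; ring
    _ ≤ K * (1 + √S ^ l) * u x ^ 2 := by gcongr

lemma energy_eq (hu : Summable fun x => u x ^ 2) :
    energy F u = d * ∑' x, u x ^ 2 - (1 / 2) * edgeSum u - ∑' x, F (euclNorm x) (u x) := by
  rw [energy, gradNormSq_eq hu]
  ring

lemma tsum_le_tsum_abs (hF : IsNonlinearity d F) (hu : Summable fun x => u x ^ 2) :
    ∑' x, F (euclNorm x) (u x) ≤ ∑' x, F (euclNorm x) |u x| :=
  (hF.summable hu).tsum_le_tsum (fun x => hF.le_abs x _)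
    (hF.summable (by simpa only [sq_abs] using hu))

lemma energy_smul_le (hF : IsNonlinearity d F) (hu0 : ∀ x, 0 ≤ u x)
    (hu : Summable fun x => u x ^ 2) {θ : ℝ} (hθ : 1 ≤ θ) :
    energy F (fun x => θ * u x) ≤ θ ^ 2 * energy F u := by
  have hu' : Summable fun x => (θ * u x) ^ 2 := by
    simpa only [mul_pow] using hu.mul_left (θ ^ 2)
  have h1 : θ ^ 2 * ∑' x, F (euclNorm x) (u x) ≤ ∑' x, F (euclNorm x) (θ * u x) := by
    rw [← tsum_mul_left]
    exact ((hF.summable hu).mul_left _).tsum_le_tsum (fun x => hF.scale x θ _ hθ (hu0 x))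
      (hF.summable hu')
  have h2 : edgeSum (fun x => θ * u x) = θ ^ 2 * edgeSum u := by
    rw [edgeSum, edgeSum, Finset.mul_sum]
    refine Finset.sum_congr rfl fun e _ => ?_
    rw [← tsum_mul_left]
    exact tsum_congr fun x => by ring
  rw [energy_eq hu, energy_eq hu', h2]
  simp only [mul_pow, tsum_mul_left]
  linarith

end IsNonlinearity

/-! ### Maximizers with bounded support -/

/-- Nonnegative functions supported in `{level ≤ R}` with `∑ u² ≤ C`. -/
def Feasible {d : ℕ} (R C : ℝ) : Set (Lattice d → ℝ) :=
  {u | (∀ x, 0 ≤ u x) ∧ (∀ x, R < level x → u x = 0) ∧ ∑' x, u x ^ 2 ≤ C}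

lemma finite_level_le (R : ℝ) : {x : Lattice d | level x ≤ R}.Finite := by
  set N : ℤ := ⌈|R|⌉ + 1
  refine (Set.finite_Icc (fun _ => -N : Lattice d) fun _ => N).subset fun x hx => ?_
  have hR : (|R| : ℝ) + 1 ≤ N := by
    push_cast [N]
    linarith [Int.le_ceil |R|]
  have key : ∀ i, |(x i : ℝ)| ≤ N := by
    intro i
    have hx' : (x i : ℝ) ^ 2 - offset i * (x i : ℝ) ≤ R := by
      refine le_trans ?_ (show level x ≤ R from hx)
      exact Finset.single_le_sum (f := fun j => (x j : ℝ) ^ 2 - offset j * (x j : ℝ))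
        (fun j _ => level_term_nonneg x j) (Finset.mem_univ i)
    have h0 := offset_pos i
    have h1 := offset_lt_one i
    have h2 := le_abs_self R
    have h3 := abs_nonneg R
    have h4 : offset i * (x i : ℝ) ≤ |(x i : ℝ)| := by
      rcases abs_cases (x i : ℝ) with ⟨h, h'⟩ | ⟨h, h'⟩ <;> nlinarith
    rw [← sq_abs] at hx'
    by_contra! h5
    nlinarith [abs_nonneg (x i : ℝ)]
  refine ⟨fun i => ?_, fun i => ?_⟩
  · have := (abs_le.1 (key i)).1
    change -N ≤ x i
    exact_mod_cast this
  · have := (abs_le.1 (key i)).2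
    change x i ≤ N
    exact_mod_cast this

section Feasible

variable {R C : ℝ}

lemma Feasible.tsum_eq (f : Lattice d → ℝ) (hf : ∀ x, R < level x → f x = 0) :
    ∑' x, f x = ∑ x ∈ (finite_level_le (d := d) R).toFinset, f x :=
  tsum_eq_sum fun x hx => hf x (by simpa using hx)

lemma Feasible.summable (f : Lattice d → ℝ) (hf : ∀ x, R < level x → f x = 0) : Summable f :=
  summable_of_ne_finset_zero (s := (finite_level_le (d := d) R).toFinset)
    fun x hx => hf x (by simpa using hx)

lemma Feasible.summable_sq (hu : u ∈ Feasible R C) : Summable fun x => u x ^ 2 :=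
  Feasible.summable _ fun x hx => by rw [hu.2.1 x hx]; ring

lemma isCompact_feasible (R C : ℝ) : IsCompact (Feasible R C : Set (Lattice d → ℝ)) := by
  have hbox : IsCompact (Set.univ.pi fun _ : Lattice d => Set.Icc 0 (√C)) :=
    isCompact_univ_pi fun _ => isCompact_Icc
  have hset : (Feasible R C : Set (Lattice d → ℝ)) = {u | ∀ x, 0 ≤ u x} ∩
      ({u | ∀ x, R < level x → u x = 0} ∩
        {u | ∑ x ∈ (finite_level_le (d := d) R).toFinset, u x ^ 2 ≤ C}) := by
    ext u
    refine and_congr_right fun _ => and_congr_right fun h => ?_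
    rw [Feasible.tsum_eq (R := R) _ fun x hx => by rw [h x hx]; ring]
    rfl
  refine hbox.of_isClosed_subset ?_ fun u hu x _ => ⟨hu.1 x, ?_⟩
  · rw [hset]
    refine IsClosed.inter ?_ (IsClosed.inter ?_ ?_)
    · simp only [Set.ofPred_forall]
      exact isClosed_iInter fun x => isClosed_le continuous_const (continuous_apply x)
    · simp only [Set.ofPred_forall]
      exact isClosed_iInter fun x => isClosed_iInter fun _ =>
        isClosed_eq (continuous_apply x) continuous_const
    · exact isClosed_le (continuous_finsetSum _ fun x _ => (continuous_apply x).pow 2)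
        continuous_const
  · refine Real.le_sqrt_of_sq_le ?_
    exact ((Feasible.summable_sq hu).le_tsum x fun _ _ => sq_nonneg _).trans hu.2.2

/-- The perturbation of `1/2 * edgeSum u + ∑ F(|x|, u x)` by a small multiple of the weighted sum of
squares is strictly increased by every nontrivial polarization, so its maximizers are reflection
symmetric. -/
theorem exists_symmetric_almost_maximizer {F : ℝ → ℝ → ℝ} (hF : IsNonlinearity d F) (R : ℝ)
    (hC : 0 ≤ C) {ε : ℝ} (hε : 0 < ε) :
    ∃ u ∈ Feasible (d := d) R C, ReflectionSymmetric u ∧ ∀ v ∈ Feasible (d := d) R C,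
      (1 / 2) * edgeSum v + ∑' x, F (euclNorm x) (v x) ≤
        (1 / 2) * edgeSum u + ∑' x, F (euclNorm x) (u x) + ε * C := by
  set G : (Lattice d → ℝ) → ℝ := fun f => (1 / 2) * edgeSum f + ∑' x, F (euclNorm x) (f x)
    + ε * ∑' x, weight x * f x ^ 2 with hG
  set B := (finite_level_le (d := d) R).toFinset
  have hcont : ContinuousOn G (Feasible R C) := by
    have h1 : ContinuousOn (fun f : Lattice d → ℝ =>
        (1 / 2) * ∑ e ∈ steps d, ∑ x ∈ B, f x * f (x + e) + ∑ x ∈ B, F (euclNorm x) (f x)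
          + ε * ∑ x ∈ B, weight x * f x ^ 2) (Feasible R C) := by
      refine ContinuousOn.add (ContinuousOn.add ?_ ?_) ?_
      · exact Continuous.continuousOn (by fun_prop)
      · exact continuousOn_finsetSum _ fun x _ =>
          (hF.cont x).comp (continuous_apply x).continuousOn fun f hf => hf.1 x
      · exact Continuous.continuousOn (by fun_prop)
    refine h1.congr fun f hf => ?_
    simp only [hG, edgeSum]
    rw [Feasible.tsum_eq (R := R) (fun x => F (euclNorm x) (f x))
        fun x hx => by rw [hf.2.1 x hx, hF.zero],
      Feasible.tsum_eq (R := R) (fun x => weight x * f x ^ 2)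
        fun x hx => by rw [hf.2.1 x hx]; ring,
      Finset.sum_congr rfl fun e _ => Feasible.tsum_eq (R := R) (fun x => f x * f (x + e))
        fun x hx => by rw [hf.2.1 x hx]; ring]
  have hne : (Feasible R C : Set (Lattice d → ℝ)).Nonempty :=
    ⟨fun _ => 0, fun _ => le_rfl, fun _ _ => rfl, by simpa using hC⟩
  have hw : ∀ f ∈ Feasible (d := d) R C, Summable fun x => weight x * f x ^ 2 := fun f hf =>
    Feasible.summable (R := R) _ fun x hx => by rw [hf.2.1 x hx]; ring
  have hs : ∀ f ∈ Feasible (d := d) R C, ∀ e, Summable fun x => f x * f (x + e) := fun f hf e =>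
    summable_mul_add (Feasible.summable_sq hf) e
  obtain ⟨u, hu, hmax⟩ := (isCompact_feasible R C).exists_isMaxOn hne hcont
  refine ⟨u, hu, ?_, fun v hv => ?_⟩
  · intro ν m h b hb x hx
    by_contra! hlt
    have hzero := fun y (hy : R < level y) =>
      IsRoot.polarize_eq_zero (ν := ν) (m := m) (b := b) hu.1 hu.2.1 hy
    have hvs : Summable fun x => polarize ν m b u x ^ 2 :=
      Feasible.summable (R := R) _ fun x hx => by rw [hzero x hx]; ring
    have hv : polarize ν m b u ∈ Feasible R C := ⟨IsRoot.polarize_nonneg hu.1, hzero,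
      (h.tsum_polarize_sq_le hb (Feasible.summable_sq hu) hvs).trans hu.2.2⟩
    have h1 := h.edgeSum_le_polarize hb (hs u hu) (hs _ hv)
    have h2 := h.nonlinear_sum_le_polarize hb hu.1 hF.supermodular
      (hF.summable (Feasible.summable_sq hu)) (hF.summable hvs)
    have h3 := h.weight_sum_lt_polarize hb hu.1 (hw u hu) (hw _ hv) hx hlt
    have h4 : G (polarize ν m b u) ≤ G u := hmax hv
    simp only [hG] at h4
    have h5 := mul_lt_mul_of_pos_left h3 hε
    linarith
  · have h1 : G v ≤ G u := hmax hv
    have h2 : 0 ≤ ∑' x, weight x * v x ^ 2 :=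
      tsum_nonneg fun x => mul_nonneg (weight_pos x).le (sq_nonneg _)
    have h3 : ∑' x, weight x * u x ^ 2 ≤ C :=
      ((hw u hu).tsum_le_tsum (fun x => mul_le_of_le_one_left (sq_nonneg _) (weight_le_one x))
        (Feasible.summable_sq hu)).trans hu.2.2
    have h4 := mul_nonneg hε.le h2
    have h5 := mul_le_mul_of_nonneg_left h3 hε.le
    simp only [hG] at h1
    linarith

end Feasible

end

section

/-! ### Passage to the limit -/

variable {d : ℕ} {u : Lattice d → ℝ}

/-- The restriction of `u` to `{level ≤ R}`. -/
noncomputable def truncate {d : ℕ} (R : ℝ) (u : Lattice d → ℝ) (x : Lattice d) : ℝ :=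
  if level x ≤ R then u x else 0

lemma truncate_nonneg (hu : ∀ x, 0 ≤ u x) (R : ℝ) (x : Lattice d) : 0 ≤ truncate R u x := by
  unfold truncate
  split_ifs
  exacts [hu x, le_rfl]

lemma truncate_le (hu : ∀ x, 0 ≤ u x) (R : ℝ) (x : Lattice d) : truncate R u x ≤ u x := by
  unfold truncate
  split_ifs
  exacts [le_rfl, hu x]

lemma truncate_eventually_eq (u : Lattice d → ℝ) (x : Lattice d) :
    ∀ᶠ n : ℕ in atTop, truncate n u x = u x := by
  filter_upwards [tendsto_natCast_atTop_atTop.eventually_ge_atTop (level x)] with n hn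
  exact if_pos hn

lemma truncate_mem_feasible (hu0 : ∀ x, 0 ≤ u x) (hu : Summable fun x => u x ^ 2) (R : ℝ) :
    truncate R u ∈ Feasible R (∑' x, u x ^ 2) := by
  have h : ∀ x, R < level x → truncate R u x = 0 := fun x hx => if_neg (not_le.2 hx)
  refine ⟨truncate_nonneg hu0 R, h, Summable.tsum_le_tsum (fun x =>
    pow_le_pow_left₀ (truncate_nonneg hu0 R x) (truncate_le hu0 R x) 2)
    (Feasible.summable (R := R) _ fun x hx => by rw [h x hx]; ring) hu⟩

lemma tendsto_edgeSum_truncate (hu0 : ∀ x, 0 ≤ u x) (hu : Summable fun x => u x ^ 2) :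
    Tendsto (fun n : ℕ => edgeSum (truncate n u)) atTop (𝓝 (edgeSum u)) := by
  refine tendsto_finsetSum _ fun e _ =>
    tendsto_tsum_of_dominated_convergence (summable_mul_add hu e) (fun x => ?_)
      (Eventually.of_forall fun n x => ?_)
  · refine tendsto_const_nhds.congr' ?_
    filter_upwards [truncate_eventually_eq u x, truncate_eventually_eq u (x + e)] with n h1 h2
    rw [h1, h2]
  · have h1 := truncate_nonneg hu0 n x
    have h2 := truncate_nonneg hu0 n (x + e)
    rw [Real.norm_of_nonneg (mul_nonneg h1 h2)]
    exact mul_le_mul (truncate_le hu0 n x) (truncate_le hu0 n _) h2 (hu0 x)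

namespace IsNonlinearity

variable {F : ℝ → ℝ → ℝ}

lemma tendsto_tsum_truncate (hF : IsNonlinearity d F) (hu : Summable fun x => u x ^ 2) :
    Tendsto (fun n : ℕ => ∑' x, F (euclNorm x) (truncate n u x)) atTop
      (𝓝 (∑' x, F (euclNorm x) (u x))) := by
  refine tendsto_tsum_of_dominated_convergence (hF.summable hu) (fun x => ?_)
    (Eventually.of_forall fun n x => ?_)
  · refine tendsto_const_nhds.congr' ?_
    filter_upwards [truncate_eventually_eq u x] with n h1
    rw [h1]
  · rw [Real.norm_of_nonneg (hF.nonneg x _), truncate]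
    split_ifs
    · exact le_rfl
    · rw [hF.zero]
      exact hF.nonneg x _

/-- Far away, reflection symmetric functions are uniformly small, so that the nonlinear term is
uniformly small there. -/
lemma exists_uniform_tail (hF : IsNonlinearity d F) (C : ℝ) {ε : ℝ} (hε : 0 < ε) :
    ∃ T : Finset (Lattice d), ∀ u : Lattice d → ℝ, ReflectionSymmetric u → (∀ x, 0 ≤ u x) →
      (∀ S : Finset (Lattice d), ∑ x ∈ S, u x ^ 2 ≤ C) →
      ∀ x ∉ T, F (euclNorm x) (u x) ≤ ε * u x ^ 2 := by
  obtain ⟨X₀, t₀, hX₀, ht₀, h⟩ := hF.small ε hε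
  obtain ⟨M, hM⟩ := exists_nat_gt (max X₀ (C / (2 * t₀ ^ 2)))
  have hM1 := (le_max_left _ _).trans_lt hM
  have hM2 := (le_max_right _ _).trans_lt hM
  refine ⟨Finset.Icc (fun _ => -(M : ℤ)) fun _ => (M : ℤ), fun u hu hu0 hC x hx => ?_⟩
  obtain ⟨i, hi⟩ : ∃ i, (M : ℝ) < |(x i : ℝ)| := by
    by_contra! hall
    refine hx (Finset.mem_Icc.2 ⟨fun i => ?_, fun i => ?_⟩)
    · have := (abs_le.1 (hall i)).1
      change -(M : ℤ) ≤ x i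
      exact_mod_cast this
    · have := (abs_le.1 (hall i)).2
      change x i ≤ (M : ℤ)
      exact_mod_cast this
  refine h x (u x) ?_ ?_
  · refine hM1.trans (hi.trans_le (Real.le_sqrt_of_sq_le ?_))
    rw [sq_abs]
    exact Finset.single_le_sum (f := fun j => (x j : ℝ) ^ 2) (fun j _ => sq_nonneg _)
      (Finset.mem_univ i)
  · rw [abs_of_nonneg (hu0 x)]
    by_contra! hle
    have h1 := hu.mul_sq_le hu0 hC x i
    have h2 : t₀ ^ 2 ≤ u x ^ 2 := pow_le_pow_left₀ ht₀.le hle 2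
    have h3 : 0 < t₀ ^ 2 := by positivity
    rw [div_lt_iff₀ (by positivity)] at hM2
    have h4 : 2 * (M : ℝ) * t₀ ^ 2 ≤ 2 * |(x i : ℝ)| * u x ^ 2 := by gcongr
    linarith

lemma tsum_le_sum_add (hF : IsNonlinearity d F) {C ε : ℝ} (hε : 0 < ε)
    (hu : Summable fun x => u x ^ 2) (hC : ∑' x, u x ^ 2 ≤ C) {T : Finset (Lattice d)}
    (hT : ∀ x ∉ T, F (euclNorm x) (u x) ≤ ε * u x ^ 2) :
    ∑' x, F (euclNorm x) (u x) ≤ ∑ x ∈ T, F (euclNorm x) (u x) + ε * C := by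
  have h1 : ∀ x, F (euclNorm x) (u x) ≤
      (if x ∈ T then F (euclNorm x) (u x) else 0) + ε * u x ^ 2 := by
    intro x
    split_ifs with hx
    · have := mul_nonneg hε.le (sq_nonneg (u x))
      linarith
    · simpa using hT x hx
  have h2 : Summable fun x => if x ∈ T then F (euclNorm x) (u x) else 0 :=
    summable_of_ne_finset_zero (s := T) fun x hx => if_neg hx
  have h3 := (hF.summable hu).tsum_le_tsum h1 (h2.add (hu.mul_left ε))
  rw [h2.tsum_add (hu.mul_left ε), tsum_mul_left,
    tsum_eq_sum (s := T) fun x hx => if_neg hx, Finset.sum_ite_mem, Finset.inter_self] at h3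
  have := mul_le_mul_of_nonneg_left hC hε.le
  linarith

/-- There is a reflection symmetric function in the closed ball of radius `|c|` whose energy is at
most that of every function on the sphere. -/
theorem exists_symmetric_energy_le (hF : IsNonlinearity d F) (c : ℝ) :
    ∃ u : Lattice d → ℝ, ReflectionSymmetric u ∧ (∀ x, 0 ≤ u x) ∧ (Summable fun x => u x ^ 2) ∧
      ∑' x, u x ^ 2 ≤ c ^ 2 ∧ ∀ v ∈ sphere d c, energy F u ≤ energy F v := by
  have hexists := fun n : ℕ => exists_symmetric_almost_maximizer hF n (sq_nonneg c)
    (ε := 1 / ((n : ℝ) + 1)) (by positivity)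
  choose w hw hsymm hmax using hexists
  have hwC : ∀ n, ∀ S : Finset (Lattice d), ∑ x ∈ S, w n x ^ 2 ≤ c ^ 2 := fun n S =>
    ((Feasible.summable_sq (hw n)).sum_le_tsum S fun _ _ => sq_nonneg _).trans (hw n).2.2
  -- A subsequence converges pointwise.
  have hbox : IsCompact (Set.univ.pi fun _ : Lattice d => Set.Icc (0 : ℝ) |c|) :=
    isCompact_univ_pi fun _ => isCompact_Icc
  obtain ⟨u, -, φ, hφ, hlim⟩ := hbox.tendsto_subseq (x := w) fun n x _ => ⟨(hw n).1 x, by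
    have := hwC n {x}
    rw [Finset.sum_singleton] at this
    exact (le_abs_self _).trans (sq_le_sq.1 this)⟩
  have hlim : ∀ x, Tendsto (fun k => w (φ k) x) atTop (𝓝 (u x)) := tendsto_pi_nhds.1 hlim
  have hu0 : ∀ x, 0 ≤ u x := fun x => ge_of_tendsto' (hlim x) fun k => (hw (φ k)).1 x
  have huC : ∀ S : Finset (Lattice d), ∑ x ∈ S, u x ^ 2 ≤ c ^ 2 := fun S =>
    le_of_tendsto' (tendsto_finsetSum S fun x _ => (hlim x).pow 2) fun k => hwC (φ k) S
  have hus : Summable fun x => u x ^ 2 := summable_of_sum_le (fun x => sq_nonneg _) huC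
  refine ⟨u, fun ν m h b hb x hx => le_of_tendsto_of_tendsto' (hlim _) (hlim _) fun k =>
    hsymm (φ k) ν m h b hb x hx, hu0, hus, hus.tsum_le_of_sum_le huC, fun v hv => ?_⟩
  have hvs : Summable fun x => v x ^ 2 := memH1_iff.1 hv.1
  have hvs' : Summable fun x => |v x| ^ 2 := by simpa only [sq_abs] using hvs
  have hvc : ∑' x, |v x| ^ 2 = c ^ 2 := by simpa only [sq_abs] using hv.2
  set J : ℝ := (1 / 2) * edgeSum (fun x => |v x|) + ∑' x, F (euclNorm x) |v x| with hJ
  have hJv : d * c ^ 2 - J ≤ energy F v := by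
    rw [energy_eq hvs, hv.2]
    have h1 := edgeSum_le_edgeSum_abs hvs
    have h2 := hF.tsum_le_tsum_abs hvs
    linarith
  -- The estimate for fixed finite sets, obtained in the limit along the subsequence.
  have key : ∀ ε : ℝ, 0 < ε → ∀ S : Finset (Lattice d),
      J + (1 / 4) * ∑ x ∈ S, localGradSq u x ≤
        d * c ^ 2 + ∑' x, F (euclNorm x) (u x) + ε * c ^ 2 := by
    intro ε hε S
    obtain ⟨T, hT⟩ := hF.exists_uniform_tail (c ^ 2) hε
    have hn : ∀ n : ℕ, (1 / 2) * edgeSum (truncate n fun x => |v x|)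
        + ∑' x, F (euclNorm x) (truncate n (fun x => |v x|) x)
        + (1 / 4) * ∑ x ∈ S, localGradSq (w n) x ≤
        d * c ^ 2 + ∑ x ∈ T, F (euclNorm x) (w n x) + ε * c ^ 2
          + 1 / ((n : ℝ) + 1) * c ^ 2 := by
      intro n
      have hws := Feasible.summable_sq (hw n)
      have h1 := hmax n (truncate n fun x => |v x|) (by
        rw [← hvc]
        exact truncate_mem_feasible (fun x => abs_nonneg _) hvs' n)
      have h2 := hF.tsum_le_sum_add hε hws (hw n).2.2 (hT (w n) (hsymm n) (hw n).1 (hwC n))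
      have h3 := gradNormSq_eq hws
      have h4 : ∑ x ∈ S, localGradSq (w n) x ≤ ∑' x, localGradSq (w n) x := by
        refine (summable_localGradSq hws).sum_le_tsum S fun x _ => ?_
        rw [localGradSq_eq_sum_steps]
        exact Finset.sum_nonneg fun e _ => sq_nonneg _
      have h5 : (d : ℝ) * ∑' x, w n x ^ 2 ≤ d * c ^ 2 :=
        mul_le_mul_of_nonneg_left (hw n).2.2 (Nat.cast_nonneg d)
      rw [gradNormSq] at h3
      linarith
    have hL := ((((tendsto_edgeSum_truncate (fun x => abs_nonneg (v x)) hvs').const_mul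
      (1 / 2)).add (hF.tendsto_tsum_truncate hvs')).comp hφ.tendsto_atTop).add
      ((tendsto_finsetSum S fun x _ => show Tendsto (fun k => localGradSq (w (φ k)) x) atTop
        (𝓝 (localGradSq u x)) by
          simp only [localGradSq_eq_sum_steps]
          exact tendsto_finsetSum _ fun e _ => ((hlim _).sub (hlim _)).pow 2).const_mul (1 / 4))
    have hR := ((((tendsto_finsetSum T fun x _ => show Tendsto
      (fun k => F (euclNorm x) (w (φ k) x)) atTop (𝓝 (F (euclNorm x) (u x))) from
        ((hF.cont x) (u x) (hu0 x)).tendsto.comp (tendsto_nhdsWithin_iff.2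
          ⟨hlim x, Eventually.of_forall fun k => (hw (φ k)).1 x⟩)).const_add (d * c ^ 2)).add_const
        (ε * c ^ 2)).add
      ((tendsto_one_div_add_atTop_nhds_zero_nat.comp hφ.tendsto_atTop).mul_const (c ^ 2)))
    have h6 := le_of_tendsto_of_tendsto' hL hR fun k => hn (φ k)
    have h7 := (hF.summable hus).sum_le_tsum T fun x _ => hF.nonneg x _
    rw [zero_mul, add_zero] at h6
    linarith
  have hgrad : ∀ ε : ℝ, 0 < ε → energy F u ≤ energy F v + ε * c ^ 2 := by
    intro ε hε
    have : ∑' x, localGradSq u x ≤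
        4 * (d * c ^ 2 + ∑' x, F (euclNorm x) (u x) + ε * c ^ 2 - J) :=
      (summable_localGradSq hus).tsum_le_of_sum_le fun S => by
        have := key ε hε S
        linarith
    rw [energy, gradNormSq]
    linarith
  refine le_of_forall_pos_le_add fun η hη => ?_
  have h1 := hgrad (η / (c ^ 2 + 1)) (by positivity)
  have h2 : η / (c ^ 2 + 1) * c ^ 2 ≤ η := by
    rw [div_mul_eq_mul_div, div_le_iff₀ (by positivity)]
    nlinarith [sq_nonneg c]
  linarith

end IsNonlinearity

end

section

/-! ### Functions of negative energy -/

variable {d : ℕ}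

/-- The centre of `tent k`, so far out that the support of `tent k` avoids a large ball around the
origin. -/
def tentCenter (d k : ℕ) : Lattice d := fun _ => 4 * (k : ℤ)

/-- A tent of height `2 k`, slope `1` and radius `2 k` in the supremum norm. -/
noncomputable def tent {d : ℕ} (k : ℕ) (x : Lattice d) : ℝ :=
  max 0 (2 * (k : ℝ) - ‖x - tentCenter d k‖)

/-- The cube around `tentCenter d k` with side length `2 r`. -/
noncomputable def cube (d k r : ℕ) : Finset (Lattice d) :=
  Finset.Icc (fun _ => 4 * (k : ℤ) - r) fun _ => 4 * (k : ℤ) + r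

lemma card_cube (d k r : ℕ) : (cube d k r).card = (2 * r + 1) ^ d := by
  rw [cube, Pi.card_Icc]
  simp only [Int.card_Icc, Finset.prod_const, Finset.card_univ, Fintype.card_fin]
  congr 1
  omega

lemma mem_cube {k r : ℕ} {x : Lattice d} : x ∈ cube d k r ↔ ‖x - tentCenter d k‖ ≤ r := by
  rw [pi_norm_le_iff_of_nonneg (Nat.cast_nonneg r), cube, Finset.mem_Icc, Pi.le_def, Pi.le_def,
    ← forall_and]
  refine forall_congr' fun i => ?_
  rw [Pi.sub_apply, Int.norm_eq_abs, tentCenter]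
  have : |((x i - 4 * (k : ℤ) : ℤ) : ℝ)| ≤ (r : ℝ) ↔ |x i - 4 * (k : ℤ)| ≤ (r : ℤ) := by
    exact_mod_cast Iff.rfl
  rw [this, abs_le]
  omega

lemma tent_nonneg (k : ℕ) (x : Lattice d) : 0 ≤ tent k x := le_max_left _ _

lemma tent_le (k : ℕ) (x : Lattice d) : tent k x ≤ 2 * k :=
  max_le (by positivity) (by linarith [norm_nonneg (x - tentCenter d k)])

lemma le_tent {k : ℕ} {x : Lattice d} (hx : x ∈ cube d k k) : (k : ℝ) ≤ tent k x :=
  le_max_of_le_right (by linarith [mem_cube.1 hx])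

lemma tent_eq_zero {k : ℕ} {x : Lattice d} (hx : 2 * (k : ℝ) < ‖x - tentCenter d k‖) :
    tent k x = 0 :=
  max_eq_left (by linarith)

lemma tent_eq_zero_of_notMem {k : ℕ} {x : Lattice d} (hx : x ∉ cube d k (2 * k)) :
    tent k x = 0 := by
  rw [mem_cube, not_le] at hx
  exact tent_eq_zero (by exact_mod_cast hx)

lemma norm_step_le {e : Lattice d} (he : e ∈ steps d) : ‖e‖ ≤ 1 := by
  have : ∀ i : Fin d, ‖(unitVec i : Lattice d)‖ ≤ 1 := by
    intro i
    rw [pi_norm_le_iff_of_nonneg zero_le_one]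
    intro j
    rw [unitVec, Pi.single_apply]
    split_ifs <;> simp
  obtain ⟨i, rfl | rfl⟩ := mem_steps.1 he
  · exact this i
  · rw [norm_neg]; exact this i

lemma abs_tent_add_sub_le (k : ℕ) (x : Lattice d) {e : Lattice d} (he : e ∈ steps d) :
    |tent k (x + e) - tent k x| ≤ 1 := by
  have h1 := norm_step_le he
  have h2 : |‖x + e - tentCenter d k‖ - ‖x - tentCenter d k‖| ≤ ‖e‖ := by
    refine (abs_norm_sub_norm_le _ _).trans ?_
    rw [show x + e - tentCenter d k - (x - tentCenter d k) = e by abel]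
  rw [abs_le] at h2
  unfold tent
  rw [abs_le]
  constructor
  · rcases max_cases (0 : ℝ) (2 * (k : ℝ) - ‖x + e - tentCenter d k‖) with ⟨h3, h4⟩ | ⟨h3, h4⟩ <;>
    rcases max_cases (0 : ℝ) (2 * (k : ℝ) - ‖x - tentCenter d k‖) with ⟨h5, h6⟩ | ⟨h5, h6⟩ <;>
    rw [h3, h5] <;> linarith
  · rcases max_cases (0 : ℝ) (2 * (k : ℝ) - ‖x + e - tentCenter d k‖) with ⟨h3, h4⟩ | ⟨h3, h4⟩ <;>
    rcases max_cases (0 : ℝ) (2 * (k : ℝ) - ‖x - tentCenter d k‖) with ⟨h5, h6⟩ | ⟨h5, h6⟩ <;>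
    rw [h3, h5] <;> linarith

lemma tsum_localGradSq_tent_le (k : ℕ) :
    ∑' x : Lattice d, localGradSq (tent k) x ≤ (4 * (k : ℝ) + 3) ^ d * (2 * d) := by
  have hzero : ∀ x ∉ cube d k (2 * k + 1), localGradSq (tent k) x = 0 := by
    intro x hx
    rw [mem_cube, not_le] at hx
    push_cast at hx
    rw [localGradSq_eq_sum_steps]
    refine Finset.sum_eq_zero fun e he => ?_
    have h1 := norm_step_le he
    have h2 := norm_sub_le (x + e - tentCenter d k) e
    rw [show x + e - tentCenter d k - e = x - tentCenter d k by abel] at h2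
    rw [tent_eq_zero (x := x) (by linarith), tent_eq_zero (x := x + e) (by linarith)]
    ring
  rw [tsum_eq_sum hzero]
  have hle : ∀ x ∈ cube d k (2 * k + 1), localGradSq (tent k) x ≤ 2 * d := by
    intro x _
    rw [localGradSq_eq_sum_steps, ← card_steps]
    have h1 := Finset.sum_le_card_nsmul (steps d) (fun e => (tent k (x + e) - tent k x) ^ 2) 1
      fun e he => by
        rw [← sq_abs]
        exact pow_le_one₀ (abs_nonneg _) (abs_tent_add_sub_le k x he)
    simpa using h1
  have h2 := Finset.sum_le_card_nsmul _ _ _ hle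
  rw [card_cube, nsmul_eq_mul] at h2
  refine h2.trans_eq ?_
  push_cast
  ring

lemma summable_tent_sq (k : ℕ) : Summable fun x : Lattice d => tent k x ^ 2 :=
  summable_of_ne_finset_zero (s := cube d k (2 * k)) fun x hx => by
    rw [tent_eq_zero_of_notMem hx]; ring

lemma tsum_tent_sq_le (k : ℕ) :
    ∑' x : Lattice d, tent k x ^ 2 ≤ (4 * (k : ℝ) + 1) ^ d * (4 * (k : ℝ) ^ 2) := by
  rw [tsum_eq_sum (s := cube d k (2 * k)) fun x hx => by
    rw [tent_eq_zero_of_notMem hx]; ring]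
  have h2 := Finset.sum_le_card_nsmul (cube d k (2 * k)) (fun x => tent k x ^ 2) (4 * (k : ℝ) ^ 2)
    fun x _ => by
      have := pow_le_pow_left₀ (tent_nonneg k x) (tent_le k x) 2
      linarith
  rw [card_cube, nsmul_eq_mul] at h2
  refine h2.trans_eq ?_
  push_cast
  ring

lemma le_tsum_tent_sq (k : ℕ) :
    (2 * (k : ℝ) + 1) ^ d * (k : ℝ) ^ 2 ≤ ∑' x : Lattice d, tent k x ^ 2 := by
  refine le_trans ?_ ((summable_tent_sq k).sum_le_tsum (cube d k k) fun x _ => sq_nonneg _)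
  have h2 := Finset.card_nsmul_le_sum (cube d k k) (fun x => tent k x ^ 2) ((k : ℝ) ^ 2)
    fun x hx => pow_le_pow_left₀ (Nat.cast_nonneg k) (le_tent hx) 2
  rw [card_cube, nsmul_eq_mul] at h2
  refine le_trans (le_of_eq ?_) h2
  push_cast
  ring

lemma le_euclNorm_of_mem_cube (hd : 1 ≤ d) {k : ℕ} {x : Lattice d} (hx : x ∈ cube d k k) :
    3 * (k : ℝ) ≤ euclNorm x := by
  set i : Fin d := ⟨0, hd⟩
  have h1 := (Finset.mem_Icc.1 hx).1 i
  have h2 : 3 * (k : ℤ) ≤ x i := by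
    change 4 * (k : ℤ) - k ≤ x i at h1
    omega
  have h3 : 3 * (k : ℝ) ≤ (x i : ℝ) := by exact_mod_cast h2
  refine h3.trans (Real.le_sqrt_of_sq_le ?_)
  exact Finset.single_le_sum (f := fun j => (x j : ℝ) ^ 2) (fun j _ => sq_nonneg _)
    (Finset.mem_univ i)

/-- A flat tent has negative energy: on the sphere of radius `|c|`, a tent of width `k` has gradient
term of order `k ^ (-2)` and nonlinear term of order at least `k ^ (-d σ)`. -/
theorem IsNonlinearity.exists_energy_neg {F : ℝ → ℝ → ℝ} (hF : IsNonlinearity d F) (hd : 1 ≤ d)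
    {δ t₁ X₁ σ : ℝ} (hδ : 0 < δ) (ht₁ : 0 < t₁) (hσ : 0 < σ) (hσd : σ < 2 / (d : ℝ))
    (hlow : ∀ (x : Lattice d) (t : ℝ), X₁ < euclNorm x → 0 < t → t < t₁ →
      δ * t ^ (2 + 2 * σ) < F (euclNorm x) t) {c : ℝ} (hc : c ≠ 0) :
    ∃ v ∈ sphere d c, energy F v < 0 := by
  have hd0 : (0 : ℝ) < d := by exact_mod_cast hd
  have hexp : 0 < 2 - d * σ := by
    rw [lt_div_iff₀ hd0] at hσd
    linarith
  have hc2 : 0 < c ^ 2 := by positivity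
  set D : ℝ := (c ^ 2 / (4 * 5 ^ d)) ^ σ with hD
  have hD0 : 0 < D := by positivity
  have hlarge : ∀ᶠ k : ℕ in atTop, 1 ≤ k ∧ X₁ < 3 * (k : ℝ) ∧ 4 * c ^ 2 / t₁ ^ 2 < (k : ℝ) ∧
      d / 2 * 3 ^ d / (δ * D) < (k : ℝ) ^ (2 - d * σ) := by
    have hnat := tendsto_natCast_atTop_atTop (R := ℝ)
    filter_upwards [eventually_ge_atTop 1, hnat.eventually_gt_atTop (X₁ / 3),
      hnat.eventually_gt_atTop (4 * c ^ 2 / t₁ ^ 2),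
      ((tendsto_rpow_atTop hexp).comp hnat).eventually_gt_atTop (d / 2 * 3 ^ d / (δ * D))]
      with k h1 h2 h3 h4
    exact ⟨h1, by linarith, h3, h4⟩
  obtain ⟨k, hk1, hkX, hkt, hkD⟩ := hlarge.exists
  have hk0 : (0 : ℝ) < k := by exact_mod_cast hk1
  have hk1' : (1 : ℝ) ≤ k := by exact_mod_cast hk1
  set A := ∑' x : Lattice d, tent k x ^ 2 with hA
  have hAlow : (2 * (k : ℝ) + 1) ^ d * (k : ℝ) ^ 2 ≤ A := le_tsum_tent_sq k
  have hAup : A ≤ (4 * (k : ℝ) + 1) ^ d * (4 * (k : ℝ) ^ 2) := tsum_tent_sq_le k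
  have hA0 : 0 < A := lt_of_lt_of_le (by positivity) hAlow
  set a : ℝ := |c| / √A with ha
  have ha0 : 0 < a := div_pos (abs_pos.2 hc) (Real.sqrt_pos.2 hA0)
  have haA : a ^ 2 * A = c ^ 2 := by
    rw [ha, div_pow, Real.sq_sqrt hA0.le, sq_abs, div_mul_cancel₀ _ hA0.ne']
  -- The square of half the height of the normalized tent.
  set s : ℝ := (a * k) ^ 2 with hs
  have hs0 : 0 < s := by positivity
  have hsup : (2 * (k : ℝ) + 1) ^ d * s ≤ c ^ 2 := by
    rw [← haA, hs, mul_pow]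
    have := mul_le_mul_of_nonneg_left hAlow (sq_nonneg a)
    linarith
  have hslow : c ^ 2 / (4 * 5 ^ d) / (k : ℝ) ^ d ≤ s := by
    rw [div_div, div_le_iff₀ (by positivity), ← haA, hs, mul_pow]
    have h1 : (4 * (k : ℝ) + 1) ^ d ≤ 5 ^ d * (k : ℝ) ^ d := by
      rw [← mul_pow]
      exact pow_le_pow_left₀ (by positivity) (by linarith) d
    have h2 : A ≤ 5 ^ d * (k : ℝ) ^ d * (4 * (k : ℝ) ^ 2) := hAup.trans (by gcongr)
    have := mul_le_mul_of_nonneg_left h2 (sq_nonneg a)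
    linarith
  have hsσ : D * (k : ℝ) ^ (2 - d * σ) ≤ (k : ℝ) ^ 2 * s ^ σ := by
    have h1 := Real.rpow_le_rpow (by positivity) hslow hσ.le
    rw [Real.div_rpow (by positivity) (by positivity), ← hD, ← Real.rpow_natCast (k : ℝ) d,
      ← Real.rpow_mul hk0.le] at h1
    rw [Real.rpow_sub hk0, Real.rpow_two]
    have := mul_le_mul_of_nonneg_left h1 (sq_nonneg (k : ℝ))
    refine le_trans (le_of_eq ?_) this
    ring
  have hmain : d / 2 * 3 ^ d < δ * ((k : ℝ) ^ 2 * s ^ σ) := by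
    rw [div_lt_iff₀ (by positivity)] at hkD
    have := mul_le_mul_of_nonneg_left hsσ hδ.le
    linarith
  have hheight : a * (2 * k) < t₁ := by
    refine lt_of_pow_lt_pow_left₀ 2 ht₁.le ?_
    have h1 : (k : ℝ) * s ≤ c ^ 2 := by
      refine le_trans (mul_le_mul_of_nonneg_right ?_ hs0.le) hsup
      calc (k : ℝ) ≤ 2 * k + 1 := by linarith
        _ ≤ (2 * (k : ℝ) + 1) ^ d := le_self_pow₀ (by linarith) (by omega)
    rw [div_lt_iff₀ (by positivity)] at hkt
    have h2 : k * (4 * s) < k * t₁ ^ 2 := by linarith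
    have h3 := lt_of_mul_lt_mul_left h2 hk0.le
    calc (a * (2 * k)) ^ 2 = 4 * s := by rw [hs]; ring
      _ < t₁ ^ 2 := h3
  set v : Lattice d → ℝ := fun x => a * tent k x with hv
  have hvs : Summable fun x => v x ^ 2 := by
    simpa only [hv, mul_pow] using (summable_tent_sq k).mul_left (a ^ 2)
  refine ⟨v, ⟨memH1_iff.2 hvs, ?_⟩, ?_⟩
  · simp only [hv, mul_pow, tsum_mul_left]
    exact haA
  · have hgrad : ∑' x, localGradSq v x = a ^ 2 * ∑' x : Lattice d, localGradSq (tent k) x := by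
      rw [← tsum_mul_left]
      refine tsum_congr fun x => ?_
      rw [localGradSq_eq_sum_steps, localGradSq_eq_sum_steps, Finset.mul_sum]
      exact Finset.sum_congr rfl fun e _ => by simp only [hv]; ring
    have hFlow : (2 * (k : ℝ) + 1) ^ d * (δ * (s * s ^ σ)) ≤ ∑' x, F (euclNorm x) (v x) := by
      refine le_trans ?_ ((hF.summable hvs).sum_le_tsum (cube d k k) fun x _ => hF.nonneg x _)
      have h2 := Finset.card_nsmul_le_sum (cube d k k) (fun x => F (euclNorm x) (v x))
        (δ * (s * s ^ σ)) fun x hx => by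
          have h3 : a * k ≤ v x := mul_le_mul_of_nonneg_left (le_tent hx) ha0.le
          have h4 : 0 < v x := lt_of_lt_of_le (by positivity) h3
          have h5 : v x < t₁ := lt_of_le_of_lt
            (mul_le_mul_of_nonneg_left (tent_le k x) ha0.le) hheight
          have h6 := hlow x (v x) (hkX.trans_le (le_euclNorm_of_mem_cube hd hx)) h4 h5
          have h7 : s * s ^ σ = (a * k) ^ (2 + 2 * σ) := by
            rw [show (2 + 2 * σ) = 2 * (1 + σ) by ring, Real.rpow_mul (by positivity),
              Real.rpow_two, ← hs, Real.rpow_add hs0, Real.rpow_one]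
          rw [h7]
          have h8 : (a * k) ^ (2 + 2 * σ) ≤ v x ^ (2 + 2 * σ) :=
            Real.rpow_le_rpow (by positivity) h3 (by positivity)
          have := mul_le_mul_of_nonneg_left h8 hδ.le
          linarith
      rw [card_cube, nsmul_eq_mul] at h2
      refine le_trans (le_of_eq ?_) h2
      push_cast
      ring
    have hpow : (4 * (k : ℝ) + 3) ^ d ≤ 3 ^ d * (2 * (k : ℝ) + 1) ^ d := by
      rw [← mul_pow]
      exact pow_le_pow_left₀ (by positivity) (by linarith) d
    have hgrad_le : (1 / 4) * (a ^ 2 * ∑' x : Lattice d, localGradSq (tent k) x) ≤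
        a ^ 2 * (2 * (k : ℝ) + 1) ^ d * (d / 2 * 3 ^ d) := by
      have h1 : ∑' x : Lattice d, localGradSq (tent k) x ≤
          3 ^ d * (2 * (k : ℝ) + 1) ^ d * (2 * d) :=
        (tsum_localGradSq_tent_le k).trans (by gcongr)
      have := mul_le_mul_of_nonneg_left h1 (sq_nonneg a)
      linarith
    have hfinal : a ^ 2 * (2 * (k : ℝ) + 1) ^ d * (d / 2 * 3 ^ d) <
        (2 * (k : ℝ) + 1) ^ d * (δ * (s * s ^ σ)) := by
      calc a ^ 2 * (2 * (k : ℝ) + 1) ^ d * (d / 2 * 3 ^ d)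
          < a ^ 2 * (2 * (k : ℝ) + 1) ^ d * (δ * ((k : ℝ) ^ 2 * s ^ σ)) :=
            mul_lt_mul_of_pos_left hmain (by positivity)
        _ = (2 * (k : ℝ) + 1) ^ d * (δ * ((a * k) ^ 2 * s ^ σ)) := by ring
    rw [energy, gradNormSq, hgrad]
    linarith

/-! ### The minimizer -/

lemma ReflectionSymmetric.const_mul {u : Lattice d → ℝ} (hu : ReflectionSymmetric u) {θ : ℝ}
    (hθ : 0 ≤ θ) : ReflectionSymmetric fun x => θ * u x := fun ν m h b hb x hx =>
  mul_le_mul_of_nonneg_left (hu ν m h b hb x hx) hθ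

lemma admissible_of_summable_sq {u : Lattice d → ℝ} (hu0 : ∀ x, 0 ≤ u x)
    (hu : Summable fun x => u x ^ 2) : Admissible u := by
  refine ⟨hu0, fun t ht => ?_⟩
  have h1 := hu.tendsto_cofinite_zero.eventually_lt_const (show 0 < t ^ 2 by positivity)
  refine (Filter.eventually_cofinite.1 h1).subset fun x hx => ?_
  have : t ^ 2 ≤ |u x| ^ 2 := pow_le_pow_left₀ ht.le (le_of_lt hx) 2
  simpa only [Set.mem_ofPred_eq, not_lt, sq_abs] using this

/-- Multiplying `exists_symmetric_energy_le` by `|c| / ‖u‖₂ ≥ 1` reaches the sphere, and does not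
raise the energy because it is negative. -/
theorem IsNonlinearity.exists_minimizer {F : ℝ → ℝ → ℝ} (hF : IsNonlinearity d F) {c : ℝ}
    (hneg : ∃ v ∈ sphere d c, energy F v < 0) :
    ∃ u ∈ sphere d c, ReflectionSymmetric u ∧ (∀ x, 0 ≤ u x) ∧
      ∀ v ∈ sphere d c, energy F u ≤ energy F v := by
  obtain ⟨u, hsymm, hu0, hus, huc, hmin⟩ := hF.exists_symmetric_energy_le c
  obtain ⟨v₀, hv₀, hneg⟩ := hneg
  have hE : energy F u < 0 := (hmin v₀ hv₀).trans_lt hneg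
  have hA0 : 0 < ∑' x, u x ^ 2 := by
    refine lt_of_le_of_ne (tsum_nonneg fun x => sq_nonneg _) fun h0 => ?_
    have hz : ∀ x, u x = 0 := fun x => by
      have h1 := hus.le_tsum x fun _ _ => sq_nonneg _
      rw [← h0] at h1
      exact pow_eq_zero_iff two_ne_zero |>.1 (le_antisymm h1 (sq_nonneg _))
    have hzero : energy F u = 0 := by
      simp [energy, gradNormSq, localGradSq, hz, hF.zero]
    linarith
  set θ : ℝ := |c| / √(∑' x, u x ^ 2) with hθ
  have hθ2 : θ ^ 2 * ∑' x, u x ^ 2 = c ^ 2 := by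
    rw [hθ, div_pow, Real.sq_sqrt hA0.le, sq_abs, div_mul_cancel₀ _ hA0.ne']
  have hθ1 : 1 ≤ θ := by
    rw [hθ, one_le_div (Real.sqrt_pos.2 hA0), ← Real.sqrt_sq_eq_abs]
    exact Real.sqrt_le_sqrt huc
  have hus' : Summable fun x => (θ * u x) ^ 2 := by
    simpa only [mul_pow] using hus.mul_left (θ ^ 2)
  refine ⟨fun x => θ * u x, ⟨memH1_iff.2 hus', ?_⟩, hsymm.const_mul (by linarith),
    fun x => mul_nonneg (by linarith) (hu0 x), fun v hv => ?_⟩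
  · simp only [mul_pow, tsum_mul_left]
    exact hθ2
  · have h1 := hF.energy_smul_le hu0 hus hθ1
    have h2 : θ ^ 2 * energy F u ≤ energy F u := by nlinarith
    exact h1.trans (h2.trans (hmin v hv))

end

end LatticeSchwarz

theorem theorem6p1 (d : ℕ) (hd : 1 ≤ d) (F : ℝ → ℝ → ℝ)
    (hF : ∀ r t : ℝ, 0 ≤ r → 0 ≤ F r t)
    (hF0 : ∀ (x : LatticeSchwarz.Lattice d) (t : ℝ),
      F (LatticeSchwarz.euclNorm x) t ≤ F (LatticeSchwarz.euclNorm x) |t|)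
    (hF1 : ∀ x : LatticeSchwarz.Lattice d,
      ContinuousOn (F (LatticeSchwarz.euclNorm x)) (Set.Ici 0))
    (hF2 : ∃ K l : ℝ, 0 < K ∧ 0 < l ∧ ∀ (x : LatticeSchwarz.Lattice d) (t : ℝ), 0 ≤ t →
      F (LatticeSchwarz.euclNorm x) t ≤ K * (t ^ 2 + t ^ (l + 2)))
    (hF3 : ∀ ε : ℝ, 0 < ε → ∃ X₀ t₀ : ℝ, 0 < X₀ ∧ 0 < t₀ ∧
      ∀ (x : LatticeSchwarz.Lattice d) (t : ℝ), X₀ < LatticeSchwarz.euclNorm x → |t| < t₀ →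
        F (LatticeSchwarz.euclNorm x) t ≤ ε * t ^ 2)
    (hF4 : LatticeSchwarz.Supermodular (fun r t => -F r t) ∧ F 0 0 = 0)
    (hF5 : ∀ (x : LatticeSchwarz.Lattice d) (θ t : ℝ), 1 ≤ θ → 0 ≤ t →
      θ ^ 2 * F (LatticeSchwarz.euclNorm x) t ≤ F (LatticeSchwarz.euclNorm x) (θ * t))
    (hF6 : ∃ δ t₁ X₁ σ : ℝ, 0 < δ ∧ 0 < t₁ ∧ 0 < X₁ ∧ 0 < σ ∧ σ < 2 / (d : ℝ) ∧
      ∀ (x : LatticeSchwarz.Lattice d) (t : ℝ), X₁ < LatticeSchwarz.euclNorm x →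
        0 < t → t < t₁ → δ * t ^ (2 + 2 * σ) < F (LatticeSchwarz.euclNorm x) t)
    (c : ℝ) :
    (∀ v ∈ LatticeSchwarz.sphere d c,
      Summable fun x => F (LatticeSchwarz.euclNorm x) (v x)) ∧
    ∃ u ∈ LatticeSchwarz.sphere d c, LatticeSchwarz.IsSchwarzSymmetric u ∧
      IsGLB (LatticeSchwarz.energy F '' LatticeSchwarz.sphere d c)
        (LatticeSchwarz.energy F u) := by
  open LatticeSchwarz in
  have hN : IsNonlinearity d F := ⟨fun x t => hF _ t (Real.sqrt_nonneg _), hF0, hF1, hF2, hF3,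
    hF4.1, hF5⟩
  refine ⟨fun v hv => hN.summable (memH1_iff.1 hv.1), ?_⟩
  obtain ⟨u, hu, hsymm, hu0, hmin⟩ : ∃ u ∈ sphere d c, ReflectionSymmetric u ∧ (∀ x, 0 ≤ u x) ∧
      ∀ v ∈ sphere d c, energy F u ≤ energy F v := by
    rcases eq_or_ne c 0 with rfl | hc
    · -- The sphere of radius zero contains the zero function only.
      have hsum : Summable fun _ : Lattice d => (0 : ℝ) ^ 2 := by simp
      refine ⟨fun _ => 0, ⟨memH1_iff.2 hsum, by simp⟩, fun _ _ _ _ _ _ _ => le_rfl,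
        fun _ => le_rfl, fun v hv => ?_⟩
      have hv0 : v = fun _ => 0 := funext fun x => by
        have h1 := (memH1_iff.1 hv.1).le_tsum x fun _ _ => sq_nonneg _
        rw [hv.2, zero_pow two_ne_zero] at h1
        exact pow_eq_zero_iff two_ne_zero |>.1 (le_antisymm h1 (sq_nonneg _))
      rw [hv0]
    · obtain ⟨δ, t₁, X₁, σ, hδ, ht₁, -, hσ, hσd, hlow⟩ := hF6
      exact hN.exists_minimizer (hN.exists_energy_neg hd hδ ht₁ hσ hσd hlow hc)
  refine ⟨u, hu, hsymm.isSchwarzSymmetric hd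
    (admissible_of_summable_sq hu0 (memH1_iff.1 hu.1)), IsLeast.isGLB ⟨⟨u, hu, rfl⟩, ?_⟩⟩
  rintro _ ⟨v, hv, rfl⟩
  exact hmin v hv
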